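/- Let $\mathbb{H}$ be the quaternions and $\mathbb{S}=\{I\in\mathbb{H}: I^2=-1\}$. The symmetrization of $E\subset\mathbb{H}$ is $\widetilde E=\{x+Iy : x,y\in\mathbb{R},\ I\in\mathbb{S},\ (x+\mathbb{S}y)\cap E\neq\varnothing\}$, and $E$ is axially symmetric if $\widetilde E=E$. An axially symmetric domain is a nonempty connected open axially symmetric set. The imaginary unit function $\mathcal{I}:\mathbb{H}\setminus\mathbb{R}\to\mathbb{S}$ is given by $\mathcal{I}(x+Iy)=I$ for $I\in\mathbb{S}$, $x\in\mathbb{R}$, $y>0$. Let $\Omega$ be an axially symmetric domain. An axially symmetric open covering $\mathcal{U}=\{U_\lambda\}_{\lambda\in\Lambda}$ of $\Omega$ is a family of axially symmetric open sets with union $\Omega$. For $L=(\lambda_0,\dots,\lambda_n)\in\Lambda^{n+1}$ put $U_L=U_{\lambda_0}\cap\dots\cap U_{\lambda_n}$. An $n$-cochain of $\mathcal{U}$ with coefficients in $\mathcal{I}\mathbb{Z}$ is a family $(f_L)_{L\in\Lambda^{n+1}}$ of continuous functions $f_L:U_L\to\mathbb{H}$, each of the form $f_L=\mathcal{I}\,n_L$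 on $U_L\setminus\mathbb{R}$ for some $n_L\in\mathbb{Z}$ (so $f_L=0$ whenever $U_L$ meets $\mathbb{R}$). With the usual coboundary $(\delta f)_{\lambda_0\dots\lambda_{n+1}}=\sum_{k=0}^{n+1}(-1)^k f_{\lambda_0\dots\widehat{\lambda_k}\dots\lambda_{n+1}}$ on $U_{\lambda_0\dots\lambda_{n+1}}$, let $H^n(\mathcal{U},\mathcal{I}\mathbb{Z})$ be the group of $n$-cocycles modulo $n$-coboundaries, and let $$H^n(\Omega,\mathcal{I}\mathbb{Z})=\varinjlim_{\mathcal{U}}H^n(\mathcal{U},\mathcal{I}\mathbb{Z})$$ be the direct limit over axially symmetric open coverings of $\Omega$ and their refinements. **Theorem.** For every axially symmetric domain $\Omega\subset\mathbb{H}$, $$H^n(\Omega,\mathcal{I}\mathbb{Z})=0\qquad\text{for all } n\ge 2.$$ -/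

import Mathlib

open scoped Quaternion

noncomputable section

namespace AxCech

/-! ### Axially symmetric sets and the imaginary unit function -/

/-- The sphere `𝕊` of imaginary units of the quaternions. -/
def imagUnits : Set ℍ[ℝ] := {I | I * I = -1}

/-- The (axial) symmetrization of `E`: all `x + I y` (`x, y` real, `I ∈ 𝕊`) such that `x + 𝕊 y`
meets `E`. -/
def symmetrization (E : Set ℍ[ℝ]) : Set ℍ[ℝ] :=
  {q | ∃ x y : ℝ, ∃ I ∈ imagUnits, q = (x : ℍ[ℝ]) + I * (y : ℍ[ℝ]) ∧
    ∃ J ∈ imagUnits, (x : ℍ[ℝ]) + J * (y : ℍ[ℝ]) ∈ E}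

/-- A set of quaternions is axially symmetric if it equals its symmetrization. -/
def IsAxiallySymmetric (E : Set ℍ[ℝ]) : Prop := symmetrization E = E

/-- An axially symmetric domain: a nonempty connected open axially symmetric set. -/
structure IsAxiallySymmetricDomain (Ω : Set ℍ[ℝ]) : Prop where
  isOpen : IsOpen Ω
  isConnected : IsConnected Ω
  isAxiallySymmetric : IsAxiallySymmetric Ω

/-- The real axis in the quaternions. -/
def realAxis : Set ℍ[ℝ] := Set.range (fun x : ℝ => (x : ℍ[ℝ]))

/-- The imaginary unit function `𝓘`, meaningful off the real axis: `𝓘 (x + I y) = I` for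
`I ∈ 𝕊` and `y > 0` (see `imUnit_eq`). Its value on the real axis is never used. -/
def imUnit (q : ℍ[ℝ]) : ℍ[ℝ] := ‖q.im‖⁻¹ • q.im

theorem imUnit_eq {I : ℍ[ℝ]} (hI : I ∈ imagUnits) (x : ℝ) {y : ℝ} (hy : 0 < y) :
    imUnit ((x : ℍ[ℝ]) + I * (y : ℍ[ℝ])) = I := by
  have hI2 : I * I = -1 := hI
  have hn : ‖I‖ = 1 := by
    have h := congrArg norm hI2
    rw [norm_mul, norm_neg, norm_one] at h
    nlinarith [norm_nonneg I]
  have hre : I.re = 0 := by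
    have h0 := congrArg QuaternionAlgebra.re hI2
    have h1 := congrArg QuaternionAlgebra.imI hI2
    have h2 := congrArg QuaternionAlgebra.imJ hI2
    have h3 := congrArg QuaternionAlgebra.imK hI2
    simp at h0 h1 h2 h3
    by_contra hne
    have e1 : I.imI = 0 := by
      have : I.re * I.imI = 0 := by linarith
      simpa [hne] using this
    have e2 : I.imJ = 0 := by
      have : I.re * I.imJ = 0 := by linarith
      simpa [hne] using this
    have e3 : I.imK = 0 := by
      have : I.re * I.imK = 0 := by linarith
      simpa [hne] using this
    rw [e1, e2, e3] at h0
    nlinarith [sq_nonneg I.re]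
  have him : ((x : ℍ[ℝ]) + I * (y : ℍ[ℝ])).im = y • I := by
    ext <;> simp [hre, mul_comm]
  rw [imUnit, him, norm_smul, hn, mul_one, Real.norm_of_nonneg hy.le, smul_smul,
    inv_mul_cancel₀ hy.ne', one_smul]

/-! ### The coefficients `𝓘ℤ` -/

/-- The group of functions `𝓘 n` on `U`, with `n` an integer, that are continuous on `U`: those
continuous `f : U → ℍ` for which there is an integer `n` with `f = n 𝓘` off the real axis. -/
def sections (U : Set ℍ[ℝ]) : AddSubgroup (U → ℍ[ℝ]) where
  carrier := {f | Continuous f ∧ ∃ n : ℤ, ∀ q : U, (q : ℍ[ℝ]) ∉ realAxis → f q = n • imUnit q}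
  zero_mem' := ⟨continuous_const, 0, fun q _ => by simp⟩
  add_mem' := by
    rintro f g ⟨hf, n, hn⟩ ⟨hg, m, hm⟩
    exact ⟨hf.add hg, n + m, fun q hq => by simp [hn q hq, hm q hq, add_smul]⟩
  neg_mem' := by
    rintro f ⟨hf, n, hn⟩
    exact ⟨hf.neg, -n, fun q hq => by simp [hn q hq]⟩

/-- Restriction of sections to a smaller set. -/
def res {U V : Set ℍ[ℝ]} (h : U ⊆ V) : sections V →+ sections U where
  toFun f := ⟨fun q => f.1 ⟨q, h q.2⟩, by
    obtain ⟨hf, n, hn⟩ := f.2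
    exact ⟨hf.comp (continuous_subtype_val.subtype_mk _), n, fun q hq => hn ⟨q, h q.2⟩ hq⟩⟩
  map_zero' := rfl
  map_add' _ _ := rfl

/-! ### Axially symmetric coverings and their Čech complexes -/

/-- An axially symmetric open covering of `Ω`. -/
structure Covering (Ω : Set ℍ[ℝ]) where
  /-- the index set -/
  Idx : Type
  /-- the members of the covering -/
  U : Idx → Set ℍ[ℝ]
  isOpen : ∀ i, IsOpen (U i)
  isAxiallySymmetric : ∀ i, IsAxiallySymmetric (U i)
  iUnion_eq : ⋃ i, U i = Ω

variable {Ω : Set ℍ[ℝ]}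

/-- The intersection `U_L` of the members of the covering listed in `L`. -/
def Covering.inter (𝒰 : Covering Ω) {m : ℕ} (L : Fin m → 𝒰.Idx) : Set ℍ[ℝ] := ⋂ k, 𝒰.U (L k)

theorem Covering.inter_subset_face (𝒰 : Covering Ω) {m : ℕ} (L : Fin (m + 1) → 𝒰.Idx)
    (k : Fin (m + 1)) : 𝒰.inter L ⊆ 𝒰.inter (L ∘ k.succAbove) := fun _ hq =>
  Set.mem_iInter.2 fun j => Set.mem_iInter.1 hq (k.succAbove j)

/-- The Čech `n`-cochains of the covering with coefficients in `𝓘ℤ`: a section over each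
`(n+1)`-fold intersection. -/
abbrev Cochain (𝒰 : Covering Ω) (n : ℕ) : Type :=
  (L : Fin (n + 1) → 𝒰.Idx) → sections (𝒰.inter L)

/-- The Čech coboundary `(δ c)_L = ∑ₖ (-1)ᵏ c_{L without its k-th entry}` on `U_L`. -/
def coboundary (𝒰 : Covering Ω) (n : ℕ) : Cochain 𝒰 n →+ Cochain 𝒰 (n + 1) where
  toFun c L := ∑ k : Fin (n + 2),
    (-1 : ℤ) ^ (k : ℕ) • res (𝒰.inter_subset_face L k) (c (L ∘ k.succAbove))
  map_zero' := by
    funext L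
    simp
  map_add' c d := by
    funext L
    simp [smul_add, Finset.sum_add_distrib]

theorem coboundary_apply (𝒰 : Covering Ω) (n : ℕ) (c : Cochain 𝒰 n)
    (L : Fin (n + 2) → 𝒰.Idx) (q : 𝒰.inter L) :
    (coboundary 𝒰 n c L).1 q = ∑ k : Fin (n + 2), (-1 : ℤ) ^ (k : ℕ) •
      (c (L ∘ k.succAbove)).1 ⟨q, 𝒰.inter_subset_face L k q.2⟩ := by
  simp [coboundary, Finset.sum_apply, res]

theorem alternating_sum_zero {ι A : Type*} [AddCommGroup A] (n : ℕ) (g : (Fin (n + 1) → ι) → A)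
    (L : Fin (n + 3) → ι) :
    ∑ j : Fin (n + 3), (-1 : ℤ) ^ (j : ℕ) • ∑ k : Fin (n + 2), (-1 : ℤ) ^ (k : ℕ) •
      g ((L ∘ j.succAbove) ∘ k.succAbove) = 0 := by
  simp only [Finset.smul_sum, ← Finset.sum_product']
  let P := Fin (n + 3) × Fin (n + 2)
  let S : Finset P := {ij : P | (ij.1 : ℕ) ≤ (ij.2 : ℕ)}
  rw [Finset.univ_product_univ, ← Finset.sum_add_sum_compl S, ← eq_neg_iff_add_eq_zero,
    ← Finset.sum_neg_distrib]
  let φ : ∀ ij : P, ij ∈ S → P := fun ij hij =>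
    (ij.2.succ, Fin.castLT ij.1 (lt_of_le_of_lt (Finset.mem_filter.mp hij).right (Fin.is_lt ij.2)))
  apply Finset.sum_bij φ
  · intro ij hij
    simp_rw [S, φ, Finset.compl_filter, Finset.mem_filter_univ, Fin.val_succ,
      Fin.val_castLT] at hij ⊢
    lia
  · rintro ⟨i, j⟩ hij ⟨i', j'⟩ hij' h
    rw [Prod.mk_inj]
    exact ⟨by simpa [φ, Fin.castSucc_castLT] using! congr_arg Fin.castSucc (congr_arg Prod.snd h),
      by simpa [φ] using! congr_arg Prod.fst h⟩
  · rintro ⟨i', j'⟩ hij'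
    simp_rw [S, Finset.compl_filter, Finset.mem_filter_univ, not_le] at hij'
    refine ⟨(Fin.castSucc j', i'.pred <| ?_), ?_, ?_⟩
    · rintro rfl
      simp only [Fin.val_zero, not_lt_zero] at hij'
    · simpa [S] using! Nat.le_sub_one_of_lt hij'
    · simp only [φ, Fin.castLT_castSucc, Fin.succ_pred]
  · rintro ⟨i, j⟩ hij
    have hle : (i : ℕ) ≤ (j : ℕ) := (Finset.mem_filter.mp hij).right
    have hface : (L ∘ i.succAbove) ∘ j.succAbove = (L ∘ j.succ.succAbove) ∘
        (Fin.castLT i (lt_of_le_of_lt hle j.is_lt)).succAbove := by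
      funext x
      simp only [Function.comp_apply]
      congr 1
      ext
      simp only [Fin.succAbove, Fin.lt_def]
      split_ifs <;> simp_all <;> omega
    simp only [φ, hface, smul_smul, ← neg_smul, Fin.val_succ, Fin.val_castLT]
    congr 1
    ring

theorem coboundary_coboundary (𝒰 : Covering Ω) (n : ℕ) (c : Cochain 𝒰 n) :
    coboundary 𝒰 (n + 1) (coboundary 𝒰 n c) = 0 := by
  classical
  funext L
  ext1
  funext q
  rw [coboundary_apply]
  have key := alternating_sum_zero n
    (fun M => if h : (q : ℍ[ℝ]) ∈ 𝒰.inter M then (c M).1 ⟨q, h⟩ else 0) L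
  refine Eq.trans (Finset.sum_congr rfl fun j _ => ?_) key
  rw [coboundary_apply]
  congr 1
  refine Finset.sum_congr rfl fun k _ => ?_
  rw [dif_pos (𝒰.inter_subset_face _ k (𝒰.inter_subset_face L j q.2))]

/-- The Čech `n`-cocycles. -/
def cocycles (𝒰 : Covering Ω) (n : ℕ) : AddSubgroup (Cochain 𝒰 n) := (coboundary 𝒰 n).ker

/-- The Čech `n`-coboundaries; there are none but `0` in degree `0`. -/
def coboundaries (𝒰 : Covering Ω) : (n : ℕ) → AddSubgroup (Cochain 𝒰 n)
  | 0 => ⊥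
  | n + 1 => (coboundary 𝒰 n).range

theorem coboundaries_le_cocycles (𝒰 : Covering Ω) (n : ℕ) :
    coboundaries 𝒰 n ≤ cocycles 𝒰 n := by
  cases n with
  | zero => exact bot_le
  | succ n =>
    rintro _ ⟨c, rfl⟩
    exact coboundary_coboundary 𝒰 n c

/-- The Čech cohomology group `Hⁿ(𝒰, 𝓘ℤ)` of the covering: cocycles modulo coboundaries. -/
abbrev coverCohomology (𝒰 : Covering Ω) (n : ℕ) : Type :=
  cocycles 𝒰 n ⧸ (coboundaries 𝒰 n).addSubgroupOf (cocycles 𝒰 n)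

/-! ### Refinements and the direct limit -/

/-- A refinement map from `𝒱` to `𝒰`: every `V_j` lies in the member `U_{r j}` of `𝒰`. -/
structure Refinement (𝒰 𝒱 : Covering Ω) where
  /-- the map of index sets -/
  r : 𝒱.Idx → 𝒰.Idx
  subset : ∀ j, 𝒱.U j ⊆ 𝒰.U (r j)

theorem Refinement.inter_subset {𝒰 𝒱 : Covering Ω} (ρ : Refinement 𝒰 𝒱) {m : ℕ}
    (L : Fin m → 𝒱.Idx) : 𝒱.inter L ⊆ 𝒰.inter (ρ.r ∘ L) := fun _ hq =>
  Set.mem_iInter.2 fun k => ρ.subset _ (Set.mem_iInter.1 hq k)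

/-- The restriction of cochains along a refinement map. -/
def Refinement.cochainMap {𝒰 𝒱 : Covering Ω} (ρ : Refinement 𝒰 𝒱) (n : ℕ) :
    Cochain 𝒰 n →+ Cochain 𝒱 n where
  toFun c L := res (ρ.inter_subset L) (c (ρ.r ∘ L))
  map_zero' := rfl
  map_add' _ _ := rfl

theorem Refinement.coboundary_cochainMap {𝒰 𝒱 : Covering Ω} (ρ : Refinement 𝒰 𝒱) (n : ℕ)
    (c : Cochain 𝒰 n) :
    coboundary 𝒱 n (ρ.cochainMap n c) = ρ.cochainMap (n + 1) (coboundary 𝒰 n c) := by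
  funext L
  ext1
  funext q
  rw [coboundary_apply]
  exact (coboundary_apply 𝒰 n c (ρ.r ∘ L) ⟨q, ρ.inter_subset L q.2⟩).symm

/-- The restriction of cocycles along a refinement map. -/
def Refinement.cocycleMap {𝒰 𝒱 : Covering Ω} (ρ : Refinement 𝒰 𝒱) (n : ℕ) :
    cocycles 𝒰 n →+ cocycles 𝒱 n where
  toFun c := ⟨ρ.cochainMap n c.1, by
    have hc : coboundary 𝒰 n c.1 = 0 := c.2
    change coboundary 𝒱 n (ρ.cochainMap n c.1) = 0
    rw [ρ.coboundary_cochainMap, hc, map_zero]⟩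
  map_zero' := rfl
  map_add' _ _ := rfl

theorem Refinement.cochainMap_mem_coboundaries {𝒰 𝒱 : Covering Ω} (ρ : Refinement 𝒰 𝒱) (n : ℕ)
    {c : Cochain 𝒰 n} (hc : c ∈ coboundaries 𝒰 n) : ρ.cochainMap n c ∈ coboundaries 𝒱 n := by
  cases n with
  | zero =>
    have h0 : c = 0 := hc
    rw [h0, map_zero]
    exact zero_mem _
  | succ n =>
    obtain ⟨b, rfl⟩ := hc
    exact ⟨ρ.cochainMap n b, ρ.coboundary_cochainMap n b⟩

/-- The map induced on cohomology by a refinement map. -/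
def Refinement.cohomologyMap {𝒰 𝒱 : Covering Ω} (ρ : Refinement 𝒰 𝒱) (n : ℕ) :
    coverCohomology 𝒰 n →+ coverCohomology 𝒱 n :=
  QuotientAddGroup.map _ _ (ρ.cocycleMap n) fun _ hc => ρ.cochainMap_mem_coboundaries n hc

open Classical in
/-- The relations of the direct limit: a class of a covering is identified with its restrictions
to all refinements of the covering. -/
def limitRelations (Ω : Set ℍ[ℝ]) (n : ℕ) :
    AddSubgroup (DirectSum (Covering Ω) fun 𝒰 => coverCohomology 𝒰 n) :=
  AddSubgroup.closure {x | ∃ (𝒰 𝒱 : Covering Ω) (ρ : Refinement 𝒰 𝒱) (h : coverCohomology 𝒰 n),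
    x = DirectSum.of (fun 𝒰 => coverCohomology 𝒰 n) 𝒰 h -
      DirectSum.of (fun 𝒰 => coverCohomology 𝒰 n) 𝒱 (ρ.cohomologyMap n h)}

/-- The Čech cohomology group `Hⁿ(Ω, 𝓘ℤ)` with respect to axially symmetric coverings: the direct
limit of the groups `Hⁿ(𝒰, 𝓘ℤ)` over the axially symmetric open coverings `𝒰` of `Ω` and their
refinements. -/
abbrev cohomology (Ω : Set ℍ[ℝ]) (n : ℕ) : Type 1 :=
  DirectSum (Covering Ω) (fun 𝒰 => coverCohomology 𝒰 n) ⧸ limitRelations Ω n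

end AxCech

end

/-! The map `profile` turns axially symmetric open sets into relatively open subsets of the closed
upper half plane. A section over such a set is an integer n, and n = 0 if the set meets the real
axis, since the limits there along I and -I are nI and -nI. The cohomology is therefore that of a
planar set relative to its real points. Gluing on the closed lower half plane, which is
contractible, makes it in degrees at least 2 the absolute cohomology of a region of the plane, and
this vanishes because squares in the plane never close up to a surface without boundary.

The proof is combinatorial. A covering is refined by slight thickenings of the maximal dyadic
squares subordinate to it. With one extra tile `none` for the lower half plane, the pattern of
intersections, among the members and with the real axis, is the nerve of a tiling
(`exists_refinement_acyc`). The nerve is built vertex by vertex along a well-order: adding v creates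
no cohomology in degree m + 1 if the link of v in the earlier vertices has none in degree m
(`acyc_of_link`). If some tile abutting v at a boundary point p comes later than v, the earlier
neighbours meet v inside its boundary minus p, that is, in intervals, and a nerve of intervals has
no cohomology in positive degrees (`IsTiling.acyc_linkOn`).

Such an order exists because every square has an abutting square that reaches higher
(`exists_abutAt_above`). The adjacency graph is thus locally finite with infinite components, and
its vertices can be pushed to infinity without infinite backward orbits (`exists_adj_wellFounded`).
Finally, `exists_refinement_mem_coboundaries` passes from the absolute to the relative statement. -/

namespace AxCech

/-! ### Cochains of complexes on ordered tuples -/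

/-- The coboundary of a function on tuples, augmented in degree zero. -/
def coface {I : Type*} {n : ℕ} (f : (Fin n → I) → ℤ) (L : Fin (n + 1) → I) : ℤ :=
  ∑ k : Fin (n + 1), (-1 : ℤ) ^ (k : ℕ) • f (L ∘ k.succAbove)

section Coface

variable {I : Type*} {n : ℕ}

theorem coface_sub (f g : (Fin n → I) → ℤ) (L : Fin (n + 1) → I) :
    coface (fun M => f M - g M) L = coface f L - coface g L := by
  simp [coface, mul_sub, Finset.sum_sub_distrib]

theorem coface_add (f g : (Fin n → I) → ℤ) (L : Fin (n + 1) → I) :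
    coface (fun M => f M + g M) L = coface f L + coface g L := by
  simp [coface, mul_add, Finset.sum_add_distrib]

theorem coface_congr {f g : (Fin n → I) → ℤ} {L : Fin (n + 1) → I}
    (h : ∀ k : Fin (n + 1), f (L ∘ k.succAbove) = g (L ∘ k.succAbove)) :
    coface f L = coface g L :=
  Finset.sum_congr rfl fun k _ => by rw [h k]

theorem coface_eq_zero {f : (Fin n → I) → ℤ} {L : Fin (n + 1) → I}
    (h : ∀ k : Fin (n + 1), f (L ∘ k.succAbove) = 0) : coface f L = 0 :=
  Finset.sum_eq_zero fun k _ => by rw [h k, smul_zero]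

theorem coface_coface (f : (Fin n → I) → ℤ) (L : Fin (n + 2) → I) :
    coface (coface f) L = 0 := by
  cases n with
  | zero =>
    have h : ∀ M : Fin 0 → I, f M = f Fin.elim0 := fun M => congrArg f (Subsingleton.elim _ _)
    simp [coface, Fin.sum_univ_succ, h]
  | succ n => exact alternating_sum_zero n f L

/-- Omitting the first entry leaves L; every other face keeps v in front and its sign is shifted by
one. Prefixing a vertex is thus a contracting homotopy. -/
theorem coface_cons (f : (Fin (n + 1) → I) → ℤ) (v : I) (L : Fin (n + 1) → I) :
    coface f (Fin.cons v L : Fin (n + 2) → I) =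
      f L - coface (fun M => f (Fin.cons v M : Fin (n + 1) → I)) L := by
  rw [coface, Fin.sum_univ_succ, coface, sub_eq_add_neg, ← Finset.sum_neg_distrib]
  congr 1
  · simp only [Fin.val_zero, pow_zero, one_smul]
    congr 1
  · refine Finset.sum_congr rfl fun k _ => ?_
    have : (Fin.cons v L : Fin (n + 2) → I) ∘ k.succ.succAbove = Fin.cons v (L ∘ k.succAbove) := by
      funext j
      refine Fin.cases ?_ (fun j => ?_) j
      · simp
      · simp
    rw [this, Fin.val_succ, pow_succ]
    simp

theorem range_comp_succAbove_subset (L : Fin (n + 1) → I) (k : Fin (n + 1)) :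
    Set.range (L ∘ k.succAbove) ⊆ Set.range L :=
  Set.range_comp_subset_range _ _

/-- Cochains on tuples of length `m + 1` that are closed on the complex `K` are exact on it. -/
def Acyc (K : Set I → Prop) (m : ℕ) : Prop :=
  ∀ f : (Fin (m + 1) → I) → ℤ, (∀ L, K (Set.range L) → coface f L = 0) →
    ∃ g : (Fin m → I) → ℤ, ∀ L, K (Set.range L) → f L = coface g L

/-- The primitive of f is f(a, ·): by `coface_cons` it has coboundary f wherever f is closed on (a,
L), and (a, L) spans a simplex again. -/
theorem acyc_of_cone {K : Set I → Prop} (a : I) (h : ∀ t, K t → K (insert a t)) (m : ℕ) :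
    Acyc K m := by
  intro f hf
  refine ⟨fun M => f (Fin.cons a M : Fin (m + 1) → I), fun L hL => ?_⟩
  have := hf (Fin.cons a L : Fin (m + 2) → I) (by rw [Fin.range_cons]; exact h _ hL)
  rw [coface_cons] at this
  linarith

/-- Any vertex is an apex; without vertices no nonempty tuple spans a simplex and the claim is void.
-/
theorem acyc_of_simplex {K : Set I → Prop} (hK : ∀ s t, s ⊆ t → K t → K s)
    (h : ∀ t : Set I, t.Nonempty → (∀ w ∈ t, K {w}) → K t) (m : ℕ) : Acyc K m := by
  by_cases hv : ∃ a, K {a}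
  · obtain ⟨a, ha⟩ := hv
    refine acyc_of_cone a (fun t ht => h _ (Set.insert_nonempty a t) ?_) m
    rintro w (rfl | hw)
    · exact ha
    · exact hK _ _ (Set.singleton_subset_iff.2 hw) ht
  · intro f _
    refine ⟨0, fun L hL => (hv ⟨L 0, hK _ _ ?_ hL⟩).elim⟩
    exact Set.singleton_subset_iff.2 ⟨0, rfl⟩

/-- The part of the link of `v` spanned by the vertices in `S`. -/
def linkOn (K : Set I → Prop) (v : I) (S : Set I) (t : Set I) : Prop :=
  t ⊆ S ∧ K (insert v t)

-- The cochain e = f(v, ·) has coboundary f on simplices through v, but need not vanish on the link.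
-- It is closed there, because f vanishes on the older simplices, so it is the coboundary of some g.
-- Subtracting this coboundary makes it vanish on the link and does not change its own coboundary.
open Classical in
theorem exists_coface_eq_of_link [LinearOrder I] {K : Set I → Prop}
    (hK : ∀ s t, s ⊆ t → K t → K s) {m : ℕ} (v : I) (hv : Acyc (linkOn K v (Set.Iio v)) m)
    (f : (Fin (m + 2) → I) → ℤ)
    (hf : ∀ L, K (Set.range L) → (∀ i, L i ≤ v) → coface f L = 0)
    (hf0 : ∀ L, K (Set.range L) → (∀ i, L i < v) → f L = 0) :
    ∃ G : (Fin (m + 1) → I) → ℤ, (∀ L, (∀ i, L i < v) → G L = 0) ∧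
      ∀ L, K (Set.range L) → (∀ i, L i ≤ v) → coface G L = f L := by
  set e : (Fin (m + 1) → I) → ℤ := fun M => f (Fin.cons v M : Fin (m + 2) → I) with he
  have hcons : ∀ {k : ℕ} (L : Fin k → I), (∀ i, L i ≤ v) →
      ∀ i, (Fin.cons v L : Fin (k + 1) → I) i ≤ v := fun L hL i =>
    Fin.cases le_rfl (fun j => by simpa using hL j) i
  have hde : ∀ L : Fin (m + 2) → I, K (insert v (Set.range L)) → (∀ i, L i ≤ v) →
      coface e L = f L := fun L hL hLv => by
    have := hf (Fin.cons v L) (by rwa [Fin.range_cons]) (hcons L hLv)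
    rw [coface_cons] at this
    simp only [he]
    linarith
  obtain ⟨g, hg⟩ := hv e fun L hL => by
    have hlt : ∀ i, L i < v := fun i => hL.1 ⟨i, rfl⟩
    rw [hde L hL.2 fun i => (hlt i).le]
    exact hf0 L (hK _ _ (Set.subset_insert _ _) hL.2) hlt
  set g' : (Fin m → I) → ℤ := fun M => if ∀ i, M i < v then g M else 0 with hg'
  refine ⟨fun L => if ∀ i, L i < v then 0 else e L - coface g' L, fun L hL => if_pos hL,
    fun L hL hLv => ?_⟩
  by_cases hlt : ∀ i, L i < v
  · rw [hf0 L hL hlt]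
    exact coface_eq_zero fun k => if_pos fun i => hlt _
  · have hvL : v ∈ Set.range L := by
      push Not at hlt
      obtain ⟨i, hi⟩ := hlt
      exact ⟨i, le_antisymm (hLv i) hi⟩
    have hins : insert v (Set.range L) = Set.range L := Set.insert_eq_of_mem hvL
    have hsub : coface (fun M => e M - coface g' M) L = f L := by
      rw [coface_sub, coface_coface, sub_zero, hde L (by rwa [hins]) hLv]
    rw [← hsub]
    refine coface_congr fun k => ?_
    split_ifs with hk
    · have hlink : linkOn K v (Set.Iio v) (Set.range (L ∘ k.succAbove)) := by
        refine ⟨?_, hK _ _ (Set.insert_subset hvL (range_comp_succAbove_subset L k)) hL⟩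
        rintro _ ⟨i, rfl⟩
        exact hk i
      rw [hg _ hlink, eq_comm, sub_eq_zero]
      exact coface_congr fun j => (if_pos fun i => hk _).symm
    · rfl

/-- The largest entry of a nonempty tuple. -/
def top [LinearOrder I] (L : Fin (n + 1) → I) : I :=
  Finset.univ.sup' Finset.univ_nonempty L

theorem le_top [LinearOrder I] (L : Fin (n + 1) → I) (i : Fin (n + 1)) : L i ≤ top L :=
  Finset.le_sup' L (Finset.mem_univ i)

theorem exists_eq_top [LinearOrder I] (L : Fin (n + 1) → I) : ∃ i, L i = top L := by
  obtain ⟨i, -, hi⟩ := Finset.exists_mem_eq_sup' Finset.univ_nonempty L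
  exact ⟨i, hi.symm⟩

-- A primitive is built by transfinite recursion. Stage v corrects the part already defined by means
-- of `exists_coface_eq_of_link`, and only its values on tuples with largest entry v are kept, so
-- earlier choices are never revised.
open Classical in
theorem acyc_of_link [LinearOrder I] [WellFoundedLT I] {K : Set I → Prop}
    (hK : ∀ s t, s ⊆ t → K t → K s) {m : ℕ} (h : ∀ v, Acyc (linkOn K v (Set.Iio v)) m) :
    Acyc K (m + 1) := by
  intro f hf
  -- The assumption on φ guards only the conclusion, so that corrections can be chosen for all φ and
  -- the recursion defined before its correctness is known.
  have step : ∀ v (φ : (Fin (m + 1) → I) → ℤ), ∃ G : (Fin (m + 1) → I) → ℤ,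
      (∀ L, (∀ i, L i < v) → G L = 0) ∧
      ((∀ L, K (Set.range L) → (∀ i, L i < v) → coface φ L = f L) →
        ∀ L, K (Set.range L) → (∀ i, L i ≤ v) → coface G L = f L - coface φ L) := by
    intro v φ
    by_cases hφ : ∀ L, K (Set.range L) → (∀ i, L i < v) → coface φ L = f L
    · obtain ⟨G, hG0, hG⟩ := exists_coface_eq_of_link hK v (h v) (fun L => f L - coface φ L)
        (fun L hL _ => by rw [coface_sub, hf L hL, coface_coface, sub_zero])
        (fun L hL hlt => by rw [hφ L hL hlt, sub_self])
      exact ⟨G, hG0, fun _ => hG⟩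
    · exact ⟨0, fun _ _ => rfl, fun h => (hφ h).elim⟩
  choose Γ hΓ0 hΓ using step
  let below (v : I) (G : ∀ w, w < v → (Fin (m + 1) → I) → ℤ) (L : Fin (m + 1) → I) : ℤ :=
    if hlt : top L < v then G (top L) hlt L else 0
  let G : I → (Fin (m + 1) → I) → ℤ := (wellFounded_lt (α := I)).fix fun v G => Γ v (below v G)
  have hG : ∀ v, G v = Γ v (below v fun w _ => G w) := fun v => (wellFounded_lt (α := I)).fix_eq _ v
  let g : (Fin (m + 1) → I) → ℤ := fun L => G (top L) L
  have hbelow : ∀ v L, (∀ i, L i < v) → below v (fun w _ => G w) L = g L := fun v L hL => by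
    obtain ⟨i, hi⟩ := exists_eq_top L
    exact dif_pos (hi ▸ hL i)
  have key : ∀ v, ∀ L, K (Set.range L) → top L = v → coface g L = f L := by
    intro v
    induction v using (wellFounded_lt (α := I)).induction with
    | _ v ih =>
      intro L hL hv
      have hLv : ∀ i, L i ≤ v := fun i => hv ▸ le_top L i
      have h1 := hΓ v (below v fun w _ => G w) (fun M hM hlt => by
        obtain ⟨i, hi⟩ := exists_eq_top M
        refine Eq.trans ?_ (ih (top M) (hi ▸ hlt i) M hM rfl)
        exact coface_congr fun k => hbelow v _ fun i => hlt _) L hL hLv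
      rw [← hG v, eq_sub_iff_add_eq, ← coface_add] at h1
      rw [← h1]
      refine coface_congr fun k => ?_
      set M := L ∘ k.succAbove
      have hMv : ∀ i, M i ≤ v := fun i => hLv _
      by_cases hlt : ∀ i, M i < v
      · rw [hbelow v M hlt, hG v, hΓ0 v _ M hlt, zero_add]
      · have htop : top M = v := by
          push Not at hlt
          obtain ⟨i, hi⟩ := hlt
          obtain ⟨j, hj⟩ := exists_eq_top M
          exact le_antisymm (hj ▸ hMv j) (hi.trans (le_top M i))
        have : below v (fun w _ => G w) M = 0 := dif_neg (by rw [htop]; exact lt_irrefl v)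
        rw [this, add_zero]
        simp only [g, htop]
  exact ⟨g, fun L hL => (key _ L hL rfl).symm⟩

/-- Elimination of vertices along any well-order extending a well-founded relation. -/
theorem acyc_of_wellFounded {K : Set I → Prop} (hK : ∀ s t, s ⊆ t → K t → K s) {m : ℕ}
    {r : I → I → Prop} (hr : WellFounded r)
    (h : ∀ v, ∀ S : Set I, (∀ w ∈ S, w ≠ v ∧ ¬ r v w) → Acyc (linkOn K v S) m) :
    Acyc K (m + 1) := by
  have : IsWellFounded I r := ⟨hr⟩
  obtain ⟨s, hrs, hs⟩ := IsWellFounded.exists_well_order_ge r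
  classical
  let : LinearOrder I := linearOrderOfSTO s
  have : WellFoundedLT I := ⟨hs.wf⟩
  refine acyc_of_link hK fun v => h v _ fun w hw => ⟨ne_of_lt hw, fun hvw => ?_⟩
  exact lt_asymm hw (show v < w from hrs _ _ hvw)

end Coface

/-! ### Escaping to infinity in a locally finite graph -/

theorem exists_adj_dist_lt {V : Type*} {G : SimpleGraph V} {v w : V} (h : G.Reachable v w)
    (hne : v ≠ w) : ∃ u, G.Adj v u ∧ G.dist u w < G.dist v w := by
  obtain ⟨p, hp⟩ := h.exists_walk_length_eq_dist
  cases p with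
  | nil => exact (hne rfl).elim
  | cons hadj q =>
    refine ⟨_, hadj, ?_⟩
    rw [← hp, SimpleGraph.Walk.length_cons]
    exact Nat.lt_succ_of_le (SimpleGraph.dist_le q)

/-- In a locally finite graph with infinite components, every vertex can be sent to a neighbour in
such a way that no backward orbit is infinite. -/
theorem exists_adj_wellFounded {V : Type*} (G : SimpleGraph V)
    (hfin : ∀ v, (G.neighborSet v).Finite) (hinf : ∀ v, {w | G.Reachable v w}.Infinite) :
    ∃ s : V → V, (∀ v, G.Adj v (s v)) ∧ WellFounded fun v w => s v = w := by
  classical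
  -- A forest of shortest paths: `par` moves one step towards the root of the component, and `desc
  -- v` consists of the vertices whose path to the root passes through v, including v.
  let root : V → V := fun v => (G.connectedComponentMk v).out
  have hroot : ∀ v, G.Reachable v (root v) := fun v =>
    SimpleGraph.ConnectedComponent.exact (Quot.out_eq (G.connectedComponentMk v)).symm
  have hroot_eq : ∀ {v w}, G.Reachable v w → root v = root w := fun h => by
    simp only [root, SimpleGraph.ConnectedComponent.sound h]
  let ht : V → ℕ := fun v => G.dist v (root v)
  have hpar : ∀ v, ∃ u, v ≠ root v → G.Adj v u ∧ ht u < ht v := fun v => by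
    by_cases hv : v = root v
    · exact ⟨v, fun h => (h hv).elim⟩
    · obtain ⟨u, hu, hd⟩ := exists_adj_dist_lt (hroot v) hv
      refine ⟨u, fun _ => ⟨hu, ?_⟩⟩
      simpa only [ht, hroot_eq hu.reachable.symm] using hd
  choose par hpar using hpar
  let P : V → V → Prop := fun x y => x ≠ root x ∧ par x = y
  have hPadj : ∀ {x y}, P x y → G.Adj x y := fun h => h.2 ▸ (hpar _ h.1).1
  have hPht : ∀ {x y}, P x y → ht y < ht x := fun h => h.2 ▸ (hpar _ h.1).2
  let desc : V → Set V := fun v => {w | Relation.ReflTransGen P w v}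
  have hdesc_ht : ∀ {v w}, w ∈ desc v → ht v ≤ ht w := fun {v w} h => by
    induction h with
    | refl => exact le_rfl
    | tail _ hP ih => exact (hPht hP).le.trans ih
  have hroot_inf : ∀ v, v = root v → (desc v).Infinite := fun v hv => by
    refine (hinf v).mono fun w hw => ?_
    induction hn : ht w using Nat.strong_induction_on generalizing w with
    | _ n ih =>
      by_cases hw0 : w = root w
      · rw [hw0, ← hroot_eq hw, ← hv]
        exact Relation.ReflTransGen.refl
      · have h := hpar w hw0
        exact Relation.ReflTransGen.head ⟨hw0, rfl⟩
          (ih _ (hn ▸ h.2) _ (hw.trans h.1.reachable) rfl)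
  -- König's lemma: v has finitely many children, so if it has infinitely many descendants, some
  -- child has too.
  have hchild : ∀ v, ∃ c, (desc v).Infinite → P c v ∧ (desc c).Infinite := fun v => by
    by_cases hv : (desc v).Infinite
    · by_contra! hc
      refine hv (Set.Finite.subset ((Set.finite_singleton v).union
        (Set.Finite.biUnion (s := {c | P c v}) ((hfin v).subset fun c hP => (hPadj hP).symm)
          fun c hP => (hc c).2 hP)) fun w hw => ?_)
      rcases Relation.ReflTransGen.cases_tail hw with h | ⟨c, hwc, hP⟩
      · exact Or.inl h.symm
      · exact Or.inr (Set.mem_biUnion (x := c) hP hwc)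
    · exact ⟨v, fun h => (hv h).elim⟩
  choose child hchild using hchild
  -- Move away from the root along an infinite branch if there is one, otherwise towards the root.
  -- Going backwards, the height drops as long as the descendants are infinite in number; once they
  -- are finite they stay so, and their number drops.
  let s : V → V := fun v => if (desc v).Infinite then child v else par v
  have hs_inf : ∀ {v}, (desc v).Infinite → P (s v) v ∧ (desc (s v)).Infinite := fun {v} hv => by
    simpa only [s, if_pos hv] using hchild v hv
  have hs_fin : ∀ {v}, ¬ (desc v).Infinite → P v (s v) := fun {v} hv => by
    refine ⟨fun h => hv (hroot_inf v h), ?_⟩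
    simp only [s, if_neg hv]
  refine ⟨s, fun v => ?_, ?_⟩
  · by_cases hv : (desc v).Infinite
    · exact (hPadj (hs_inf hv).1).symm
    · exact hPadj (hs_fin hv)
  have acc_fin : ∀ n v, ¬ (desc v).Infinite → (desc v).ncard = n →
      Acc (fun v w => s v = w) v := by
    intro n
    induction n using Nat.strong_induction_on with
    | _ n ih =>
      intro v hv hn
      refine Acc.intro v fun u hu => ?_
      have hu_fin : ¬ (desc u).Infinite := fun h => hv (hu ▸ (hs_inf h).2)
      have hP : P u v := hu ▸ hs_fin hu_fin
      refine ih _ ?_ u hu_fin rfl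
      rw [← hn]
      refine Set.ncard_lt_ncard ⟨fun w hw => Relation.ReflTransGen.tail hw hP, fun h => ?_⟩
        (Set.not_infinite.1 hv)
      exact absurd (hdesc_ht (h (Relation.ReflTransGen.refl : v ∈ desc v)))
        (not_le.2 (hPht hP))
  refine ⟨fun v => ?_⟩
  induction hn : ht v using Nat.strong_induction_on generalizing v with
  | _ n ih =>
    by_cases hv : (desc v).Infinite
    · refine Acc.intro v fun u hu => ?_
      by_cases hu_inf : (desc u).Infinite
      · have hP : P v u := hu ▸ (hs_inf hu_inf).1
        exact ih _ (hn ▸ hPht hP) u rfl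
      · exact acc_fin _ u hu_inf rfl
    · exact acc_fin _ v hv rfl

open Topology Complex

/-! ### The nerve of a family of closed convex tiles of the plane -/

/-- The nerve of a family of sets. -/
def nerve {J X : Type*} (T : J → Set X) (t : Set J) : Prop :=
  ∃ z, ∀ j ∈ t, z ∈ T j

theorem nerve_mono {J X : Type*} (T : J → Set X) (s t : Set J) (h : s ⊆ t) :
    nerve T t → nerve T s := fun ⟨z, hz⟩ => ⟨z, fun j hj => hz j (h hj)⟩

/-- Closed convex sets with dense and pairwise disjoint interiors. -/
structure IsTiling {J : Type*} (T : J → Set ℂ) : Prop where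
  convex : ∀ j, Convex ℝ (T j)
  isClosed : ∀ j, IsClosed (T j)
  subset_closure : ∀ j, T j ⊆ closure (interior (T j))
  disjoint : ∀ i j, i ≠ j → Disjoint (interior (T i)) (T j)

/-- Two tiles abut at `p` if they fill a neighbourhood of their common point `p`. -/
def AbutAt (A B : Set ℂ) (p : ℂ) : Prop := p ∈ A ∧ p ∈ B ∧ A ∪ B ∈ 𝓝 p

/-- A third tile through p would have interior points near p, and these lie in one of the two
abutting tiles. -/
theorem IsTiling.notMem_of_abutAt {J : Type*} {T : J → Set ℂ} (hT : IsTiling T) {u v w : J} {p : ℂ}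
    (hp : AbutAt (T u) (T v) p) (hu : w ≠ u) (hv : w ≠ v) : p ∉ T w := fun hw => by
  obtain ⟨y, hy, hyw⟩ := mem_closure_iff_nhds.1 (hT.subset_closure w hw) _ hp.2.2
  rcases hy with hy | hy
  · exact Set.disjoint_left.1 (hT.disjoint w u hu) hyw hy
  · exact Set.disjoint_left.1 (hT.disjoint w v hv) hyw hy

theorem mem_interior_of_ray {A : Set ℂ} (hA : Convex ℝ A) {c z : ℂ}
    (hc : c ∈ interior A) (hz : z ∈ A) {t : ℝ} (ht0 : 0 ≤ t) (ht1 : t < 1) :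
    c + t • (z - c) ∈ interior A := by
  have := hA.combo_interior_self_mem_interior hc hz (sub_pos.2 ht1) ht0 (by ring)
  convert this using 1
  simp only [real_smul, ofReal_sub, ofReal_one]
  ring

/-- The direction of `z` seen from `c`, with the cut through `p`. -/
noncomputable def angleFrom (c p z : ℂ) : ℝ := arg (-(z - c) / (p - c))

/-- A ray from the interior point c contains at most one point of A that is not interior. On the ray
through p this is p, which is not in B; so z is off that ray, the only place where `angleFrom`
jumps. -/
theorem slit_of_boundary {A B : Set ℂ} (hA : Convex ℝ A) {c p z : ℂ} (hc : c ∈ interior A)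
    (hpA : p ∈ A) (hpi : p ∉ interior A) (hpB : p ∉ B) (hzA : z ∈ A) (hzi : z ∉ interior A)
    (hzB : z ∈ B) : -(z - c) / (p - c) ∈ slitPlane := by
  have hpc : p - c ≠ 0 := fun h => hpi (by rwa [sub_eq_zero.1 h])
  by_contra hs
  rw [mem_slitPlane_iff, not_or, not_lt, not_not] at hs
  obtain ⟨t, ht⟩ : ∃ t : ℝ, -(z - c) / (p - c) = ((-t : ℝ) : ℂ) :=
    ⟨-(-(z - c) / (p - c)).re, Complex.ext (by simp) (by simpa using hs.2)⟩
  have ht0 : 0 ≤ t := by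
    have := hs.1
    rw [ht, ofReal_re] at this
    linarith
  have hz : z - c = t • (p - c) := by
    rw [div_eq_iff hpc] at ht
    rw [real_smul, ← neg_inj, ht]
    simp
  rcases lt_trichotomy t 1 with h1 | h1 | h1
  · apply hzi
    have := mem_interior_of_ray hA hc hpA ht0 h1
    rwa [← hz, add_sub_cancel] at this
  · apply hpB
    rw [h1, one_smul, sub_left_inj] at hz
    rwa [← hz]
  · apply hpi
    have := mem_interior_of_ray hA hc hzA (inv_nonneg.2 ht0) (inv_lt_one_of_one_lt₀ h1)
    rwa [hz, smul_smul, inv_mul_cancel₀ (by positivity), one_smul, add_sub_cancel] at this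

/-- Equal angles put both points on one ray from c, and the nearer one would be interior to A. The
angle is thus an injective coordinate on the boundary. -/
theorem eq_of_angleFrom_eq {A : Set ℂ} (hA : Convex ℝ A) {c p z w : ℂ} (hc : c ∈ interior A)
    (hpi : p ≠ c) (hzA : z ∈ A) (hzi : z ∉ interior A) (hwA : w ∈ A) (hwi : w ∉ interior A)
    (h : angleFrom c p z = angleFrom c p w) : z = w := by
  have hpc : p - c ≠ 0 := sub_ne_zero.2 hpi
  have aux : ∀ {z w : ℂ}, z ∈ A → z ∉ interior A → w ∈ A → w ∉ interior A → ∀ r : ℝ, 0 < r →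
      w - c = r • (z - c) → r < 1 → False := fun {z w} hz _ _ hw r hr hwz h1 => by
    have := mem_interior_of_ray hA hc hz hr.le h1
    rw [← hwz, add_sub_cancel] at this
    exact hw this
  have hz0 : -(z - c) / (p - c) ≠ 0 := by
    refine div_ne_zero (neg_ne_zero.2 (sub_ne_zero.2 ?_)) hpc
    rintro rfl
    exact hzi hc
  have hw0 : -(w - c) / (p - c) ≠ 0 := by
    refine div_ne_zero (neg_ne_zero.2 (sub_ne_zero.2 ?_)) hpc
    rintro rfl
    exact hwi hc
  have h' := (arg_eq_arg_iff hz0 hw0).1 h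
  set r : ℝ := ‖-(w - c) / (p - c)‖ / ‖-(z - c) / (p - c)‖ with hr
  have hr0 : 0 < r := div_pos (norm_pos_iff.2 hw0) (norm_pos_iff.2 hz0)
  have hwz : w - c = r • (z - c) := by
    rw [← ofReal_div, ← hr, mul_div_assoc', div_left_inj' hpc] at h'
    rw [real_smul, ← neg_inj, ← h']
    ring
  rcases lt_trichotomy r 1 with h1 | h1 | h1
  · exact (aux hzA hzi hwA hwi r hr0 hwz h1).elim
  · rw [h1, one_smul, sub_left_inj] at hwz
    exact hwz.symm
  · refine (aux hwA hwi hzA hzi r⁻¹ (inv_pos.2 hr0) ?_ (inv_lt_one_of_one_lt₀ h1)).elim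
    rw [hwz, smul_smul, inv_mul_cancel₀ hr0.ne', one_smul]

/-- The traces of the tiles of S on the boundary of `T v` avoid p, so the angle turns them into
intervals. Eliminate these in the order of their left endpoints: the intervals that start no later
than that of w and meet it all contain its left endpoint, so the link of w is a simplex. -/
theorem IsTiling.acyc_linkOn {J : Type*} {T : J → Set ℂ} (hT : IsTiling T) {v u : J} (huv : u ≠ v)
    (hcomp : IsCompact (T v)) (hfin : {w | (T w ∩ T v).Nonempty}.Finite) {p : ℂ}
    (hp : AbutAt (T u) (T v) p) {S : Set J} (hS : ∀ w ∈ S, w ≠ v ∧ w ≠ u) (m : ℕ) :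
    Acyc (linkOn (nerve T) v S) (m + 1) := by
  classical
  obtain ⟨c, hc⟩ : (interior (T v)).Nonempty :=
    closure_nonempty_iff.1 ⟨p, hT.subset_closure v hp.2.1⟩
  have hpi : p ∉ interior (T v) := fun h => Set.disjoint_left.1 (hT.disjoint v u huv.symm) h hp.1
  have hpc : p ≠ c := fun h => hpi (h ▸ hc)
  have hbd : ∀ {w z}, w ∈ S → z ∈ T w → z ∉ interior (T v) := fun hw hz h =>
    Set.disjoint_left.1 (hT.disjoint v _ (hS _ hw).1.symm) h hz
  have hslit : ∀ {w z}, w ∈ S → z ∈ T w → z ∈ T v → -(z - c) / (p - c) ∈ slitPlane :=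
    fun {w z} hw hz hzv => slit_of_boundary (hT.convex v) hc hp.2.1 hpi
      (hT.notMem_of_abutAt hp (hS w hw).2 (hS w hw).1) hzv (hbd hw hz) hz
  have hcont : ∀ {w}, w ∈ S → ContinuousOn (angleFrom c p) (T w ∩ T v) := fun {w} hw z hz => by
    refine ContinuousAt.continuousWithinAt ?_
    unfold angleFrom
    exact ContinuousAt.comp (g := arg) (continuousAt_arg (hslit hw hz.1 hz.2)) (by fun_prop)
  let F : Set J := {w | w ∈ S ∧ (T w ∩ T v).Nonempty}
  have hmin : ∀ w, ∃ z, w ∈ F → z ∈ T w ∩ T v ∧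
      ∀ y ∈ T w ∩ T v, angleFrom c p z ≤ angleFrom c p y := fun w => by
    by_cases hw : w ∈ F
    · obtain ⟨z, hz, hzm⟩ := (hcomp.inter_left (hT.isClosed w)).exists_isMinOn hw.2 (hcont hw.1)
      exact ⟨z, fun _ => ⟨hz, fun y hy => hzm hy⟩⟩
    · exact ⟨0, fun h => (hw h).elim⟩
  choose ζ hζ using hmin
  let r : J → J → Prop := fun w w' => w ∈ F ∧ w' ∈ F ∧ angleFrom c p (ζ w) < angleFrom c p (ζ w')
  have hr : WellFounded r := by
    have hF : F.Finite := hfin.subset fun w hw => hw.2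
    have hwf := hF.wellFoundedOn (r := fun a b => angleFrom c p (ζ a) < angleFrom c p (ζ b))
    rw [Set.wellFoundedOn_iff] at hwf
    exact Subrelation.wf (fun h => ⟨h.2.2, h.1, h.2.1⟩) hwf
  refine acyc_of_wellFounded (fun s t hst ht => ⟨hst.trans ht.1,
    nerve_mono T _ _ (Set.insert_subset_insert hst) ht.2⟩) hr fun w S' hS' => ?_
  refine acyc_of_simplex (fun s t hst ht => ⟨hst.trans ht.1,
    (Set.insert_subset_insert hst).trans ht.2.1,
    nerve_mono T _ _ (Set.insert_subset_insert (Set.insert_subset_insert hst)) ht.2.2⟩)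
    (fun t ⟨w₀, hw₀⟩ ht => ?_) m
  obtain ⟨-, hwS, y₀, hy₀⟩ := ht w₀ hw₀
  have hw : w ∈ F := ⟨hwS (Set.mem_insert _ _), y₀, hy₀ _ (by simp), hy₀ _ (by simp)⟩
  refine ⟨fun w' hw' => (ht w' hw').1 rfl, Set.insert_subset hw.1 fun w' hw' =>
    (ht w' hw').2.1 (by simp), ζ w, ?_⟩
  rintro w' (rfl | rfl | hw')
  · exact ((hζ w hw).1).2
  · exact ((hζ _ hw).1).1
  obtain ⟨hS'w, hw'S, y, hy⟩ := ht w' hw'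
  have hyw : y ∈ T w ∩ T v := ⟨hy _ (by simp), hy _ (by simp)⟩
  have hyw' : y ∈ T w' ∩ T v := ⟨hy _ (by simp), hy _ (by simp)⟩
  have hw'F : w' ∈ F := ⟨hw'S (by simp), y, hyw'⟩
  have hle : angleFrom c p (ζ w') ≤ angleFrom c p (ζ w) :=
    not_lt.1 fun h => (hS' w' (hS'w rfl)).2 ⟨hw, hw'F, h⟩
  -- The trace of w' is connected, so its angles fill the range from its minimum to that of y, which
  -- includes the angle of `ζ w`. Injectivity then makes x equal to `ζ w`.
  obtain ⟨x, hx, hxw⟩ := ((((hT.convex w').inter (hT.convex v)).isPreconnected.image _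
    (hcont hw'F.1)).ordConnected).out ⟨_, (hζ w' hw'F).1, rfl⟩ ⟨y, hyw', rfl⟩
    ⟨hle, (hζ w hw).2 y hyw⟩
  have hwv := (hζ w hw).1
  rw [← eq_of_angleFrom_eq (hT.convex v) hc hpc hx.2 (hbd hw'F.1 hx.1) hwv.2 (hbd hw.1 hwv.1) hxw]
  exact hx.1

/-- The nerve of a locally finite tiling by an unbounded tile and compact tiles has no cohomology in
degrees at least two, if the compact tiles can be sent to abutting tiles without infinite backward
orbits. -/
theorem IsTiling.acyc_nerve {J : Type*} {T : Option J → Set ℂ} (hT : IsTiling T)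
    (hcomp : ∀ j, IsCompact (T (some j)))
    (hfin : ∀ j, {w | (T w ∩ T (some j)).Nonempty}.Finite) {s : J → J}
    (hs : ∀ j, s j ≠ j ∧ ∃ p, AbutAt (T (some (s j))) (T (some j)) p)
    (hwf : WellFounded fun i j => s i = j) (m : ℕ) : Acyc (nerve T) (m + 2) := by
  -- The unbounded tile comes first, and each compact tile precedes the one it is sent to by s.
  let r : Option J → Option J → Prop := fun a b =>
    match a, b with
    | none, some _ => True
    | some i, some j => s i = j
    | _, none => False
  have hnone : Acc r none := Acc.intro _ fun b hb => by cases b <;> exact hb.elim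
  have hr : WellFounded r := ⟨fun a => by
    cases a with
    | none => exact hnone
    | some j =>
      induction j using hwf.induction with
      | _ j ih =>
        refine Acc.intro _ fun b hb => ?_
        cases b with
        | none => exact hnone
        | some i => exact ih i hb⟩
  refine acyc_of_wellFounded (nerve_mono T) hr fun v S hS => ?_
  cases v with
  | none =>
    refine acyc_of_simplex (fun s t hst ht => ⟨hst.trans ht.1,
      nerve_mono T _ _ (Set.insert_subset_insert hst) ht.2⟩) (fun t ⟨w, hw⟩ ht => ?_) _
    have hwS : w ∈ S := (ht w hw).1 rfl
    cases w with
    | none => exact ((hS _ hwS).1 rfl).elim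
    | some j => exact ((hS _ hwS).2 trivial).elim
  | some j =>
    obtain ⟨hne, p, hp⟩ := hs j
    refine hT.acyc_linkOn (u := some (s j)) (by simpa using hne) (hcomp j) (hfin j) hp
      (fun w hw => ⟨(hS w hw).1, ?_⟩) m
    rintro rfl
    exact (hS _ hw).2 rfl

/-! ### Dyadic tilings subordinate to an open covering of a part of the upper half plane -/

/-- The closed dyadic square of level `q.1` and position `q.2`. -/
def dyadicSquare (q : ℕ × ℤ × ℤ) : Set ℂ :=
  Set.Icc ((q.2.1 : ℝ) / 2 ^ q.1) ((q.2.1 + 1 : ℝ) / 2 ^ q.1) ×ℂ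
    Set.Icc ((q.2.2 : ℝ) / 2 ^ q.1) ((q.2.2 + 1 : ℝ) / 2 ^ q.1)

/-- The point `z` lies in the half-open dyadic square `q`. -/
def InHalfOpen (q : ℕ × ℤ × ℤ) (z : ℂ) : Prop :=
  ((q.2.1 : ℝ) ≤ 2 ^ q.1 * z.re ∧ 2 ^ q.1 * z.re < q.2.1 + 1) ∧
    ((q.2.2 : ℝ) ≤ 2 ^ q.1 * z.im ∧ 2 ^ q.1 * z.im < q.2.2 + 1)

theorem mem_dyadicSquare {q : ℕ × ℤ × ℤ} {z : ℂ} : z ∈ dyadicSquare q ↔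
    ((q.2.1 : ℝ) ≤ 2 ^ q.1 * z.re ∧ 2 ^ q.1 * z.re ≤ q.2.1 + 1) ∧
      ((q.2.2 : ℝ) ≤ 2 ^ q.1 * z.im ∧ 2 ^ q.1 * z.im ≤ q.2.2 + 1) := by
  have h : (0 : ℝ) < 2 ^ q.1 := by positivity
  rw [dyadicSquare, mem_reProdIm, Set.mem_Icc, Set.mem_Icc, div_le_iff₀' h, div_le_iff₀' h,
    le_div_iff₀' h, le_div_iff₀' h]

theorem mem_interior_dyadicSquare {q : ℕ × ℤ × ℤ} {z : ℂ} : z ∈ interior (dyadicSquare q) ↔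
    ((q.2.1 : ℝ) < 2 ^ q.1 * z.re ∧ 2 ^ q.1 * z.re < q.2.1 + 1) ∧
      ((q.2.2 : ℝ) < 2 ^ q.1 * z.im ∧ 2 ^ q.1 * z.im < q.2.2 + 1) := by
  have h : (0 : ℝ) < 2 ^ q.1 := by positivity
  rw [dyadicSquare, interior_reProdIm, interior_Icc, interior_Icc, mem_reProdIm, Set.mem_Ioo,
    Set.mem_Ioo, div_lt_iff₀' h, div_lt_iff₀' h, lt_div_iff₀' h, lt_div_iff₀' h]

theorem InHalfOpen.mem {q : ℕ × ℤ × ℤ} {z : ℂ} (h : InHalfOpen q z) : z ∈ dyadicSquare q :=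
  mem_dyadicSquare.2 ⟨⟨h.1.1, h.1.2.le⟩, h.2.1, h.2.2.le⟩

theorem inHalfOpen_of_mem_interior {q : ℕ × ℤ × ℤ} {z : ℂ} (h : z ∈ interior (dyadicSquare q)) :
    InHalfOpen q z := by
  rw [mem_interior_dyadicSquare] at h
  exact ⟨⟨h.1.1.le, h.1.2⟩, h.2.1.le, h.2.2⟩

theorem isClosed_dyadicSquare (q : ℕ × ℤ × ℤ) : IsClosed (dyadicSquare q) :=
  isClosed_Icc.reProdIm isClosed_Icc

theorem isCompact_dyadicSquare (q : ℕ × ℤ × ℤ) : IsCompact (dyadicSquare q) :=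
  isCompact_Icc.reProdIm isCompact_Icc

theorem convex_dyadicSquare (q : ℕ × ℤ × ℤ) : Convex ℝ (dyadicSquare q) :=
  ((convex_Icc _ _).linear_preimage reLm).inter ((convex_Icc _ _).linear_preimage imLm)

theorem dyadicSquare_subset_closure (q : ℕ × ℤ × ℤ) :
    dyadicSquare q ⊆ closure (interior (dyadicSquare q)) := by
  have h : ∀ a : ℤ, (a : ℝ) / 2 ^ q.1 ≠ (a + 1 : ℝ) / 2 ^ q.1 := fun a => by
    refine ne_of_lt ?_
    gcongr
    exact lt_add_one _
  rw [dyadicSquare, interior_reProdIm, interior_Icc, interior_Icc, closure_reProdIm,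
    closure_Ioo (h _), closure_Ioo (h _)]

theorem norm_sub_le_of_mem_dyadicSquare {q : ℕ × ℤ × ℤ} {z w : ℂ} (hz : z ∈ dyadicSquare q)
    (hw : w ∈ dyadicSquare q) : ‖z - w‖ ≤ 2 / 2 ^ q.1 := by
  have h : (0 : ℝ) < 2 ^ q.1 := by positivity
  rw [mem_dyadicSquare] at hz hw
  have h1 : |(z - w).re| ≤ 1 / 2 ^ q.1 := by
    rw [le_div_iff₀' h, ← abs_of_pos h, ← abs_mul, abs_le, sub_re, mul_sub]
    constructor <;> linarith [hz.1.1, hz.1.2, hw.1.1, hw.1.2]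
  have h2 : |(z - w).im| ≤ 1 / 2 ^ q.1 := by
    rw [le_div_iff₀' h, ← abs_of_pos h, ← abs_mul, abs_le, sub_im, mul_sub]
    constructor <;> linarith [hz.2.1, hz.2.2, hw.2.1, hw.2.2]
  calc ‖z - w‖ ≤ |(z - w).re| + |(z - w).im| := norm_le_abs_re_add_abs_im _
    _ ≤ 1 / 2 ^ q.1 + 1 / 2 ^ q.1 := add_le_add h1 h2
    _ = 2 / 2 ^ q.1 := by ring

/-- The dyadic square of level `k` around a point. -/
noncomputable def squareAt (k : ℕ) (z : ℂ) : ℕ × ℤ × ℤ := (k, ⌊2 ^ k * z.re⌋, ⌊2 ^ k * z.im⌋)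

theorem inHalfOpen_squareAt (k : ℕ) (z : ℂ) : InHalfOpen (squareAt k z) z :=
  ⟨⟨Int.floor_le _, Int.lt_floor_add_one _⟩, Int.floor_le _, Int.lt_floor_add_one _⟩

theorem InHalfOpen.eq_squareAt {q : ℕ × ℤ × ℤ} {z : ℂ} (h : InHalfOpen q z) :
    q = squareAt q.1 z := by
  obtain ⟨k, m, n⟩ := q
  simp only [squareAt, Prod.mk.injEq, true_and]
  exact ⟨(Int.floor_eq_iff.2 h.1).symm, (Int.floor_eq_iff.2 h.2).symm⟩

theorem dyadic_le_of_le {k l : ℕ} (hkl : k ≤ l) {a b : ℤ} {x : ℝ} (ha : (a : ℝ) ≤ 2 ^ k * x)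
    (ha' : 2 ^ k * x < a + 1) (hb : (b : ℝ) ≤ 2 ^ l * x) (hb' : 2 ^ l * x < b + 1) {y : ℝ}
    (hy : (b : ℝ) ≤ 2 ^ l * y) (hy' : 2 ^ l * y ≤ b + 1) :
    (a : ℝ) ≤ 2 ^ k * y ∧ 2 ^ k * y ≤ a + 1 := by
  obtain ⟨j, rfl⟩ := Nat.exists_eq_add_of_le hkl
  have hj : (0 : ℝ) < 2 ^ j := by positivity
  rw [pow_add, mul_comm ((2 : ℝ) ^ k), mul_assoc] at hb hb' hy hy'
  have h1 : (2 : ℤ) ^ j * a < b + 1 := by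
    have : (2 : ℝ) ^ j * a < b + 1 := (mul_le_mul_of_nonneg_left ha hj.le).trans_lt hb'
    exact_mod_cast this
  have h2 : b < (2 : ℤ) ^ j * (a + 1) := by
    have : (b : ℝ) < 2 ^ j * (a + 1) := hb.trans_lt (mul_lt_mul_of_pos_left ha' hj)
    exact_mod_cast this
  have h1' : (2 : ℝ) ^ j * a ≤ b := by exact_mod_cast Int.lt_add_one_iff.1 h1
  have h2' : (b : ℝ) + 1 ≤ 2 ^ j * (a + 1) := by exact_mod_cast Int.add_one_le_iff.2 h2
  exact ⟨le_of_mul_le_mul_left (h1'.trans hy) hj, le_of_mul_le_mul_left (hy'.trans h2') hj⟩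

theorem dyadicSquare_subset {q q' : ℕ × ℤ × ℤ} (hq : q.1 ≤ q'.1) {z : ℂ} (h : InHalfOpen q z)
    (h' : InHalfOpen q' z) : dyadicSquare q' ⊆ dyadicSquare q := fun w hw => by
  rw [mem_dyadicSquare] at hw ⊢
  exact ⟨dyadic_le_of_le hq h.1.1 h.1.2 h'.1.1 h'.1.2 hw.1.1 hw.1.2,
    dyadic_le_of_le hq h.2.1 h.2.2 h'.2.1 h'.2.2 hw.2.1 hw.2.2⟩

theorem InHalfOpen.of_subset {q q' : ℕ × ℤ × ℤ} (hs : dyadicSquare q ⊆ dyadicSquare q') {z : ℂ}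
    (h : InHalfOpen q z) : InHalfOpen q' z := by
  have hk : (0 : ℝ) < 2 ^ q.1 := by positivity
  have hk' : (0 : ℝ) < 2 ^ q'.1 := by positivity
  have hz := mem_dyadicSquare.1 (hs h.mem)
  -- The upper right corner of q lies in q' as well, which gives the strict inequalities.
  set c : ℂ := ⟨(q.2.1 + 1) / 2 ^ q.1, (q.2.2 + 1) / 2 ^ q.1⟩ with hc
  have hcm : c ∈ dyadicSquare q := by
    rw [mem_dyadicSquare]
    simp only [hc, mul_div_cancel₀ _ hk.ne']
    simp
  have hc' := mem_dyadicSquare.1 (hs hcm)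
  have h1 : z.re < c.re := by
    rw [hc, lt_div_iff₀' hk]
    exact h.1.2
  have h2 : z.im < c.im := by
    rw [hc, lt_div_iff₀' hk]
    exact h.2.2
  exact ⟨⟨hz.1.1, (mul_lt_mul_of_pos_left h1 hk').trans_le hc'.1.2⟩, hz.2.1,
    (mul_lt_mul_of_pos_left h2 hk').trans_le hc'.2.2⟩

/-! ### Maximal dyadic squares: local finiteness, adjacency and thickening -/

section Tiles

variable {Λ : Type*} (O : Λ → Set ℂ)

/-- The maximal dyadic squares in the upper half plane contained in some `O i`. -/
def tiles : Set (ℕ × ℤ × ℤ) :=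
  {q | 0 ≤ q.2.2 ∧ (∃ i, dyadicSquare q ⊆ O i) ∧
    ∀ q', q'.1 < q.1 → dyadicSquare q ⊆ dyadicSquare q' → ¬ ∃ i, dyadicSquare q' ⊆ O i}

theorem exists_forall_le_subset {O : Set ℂ} (hO : IsOpen O) {z : ℂ} (hz : z ∈ O) :
    ∃ ε > 0, ∃ k : ℕ, ∀ q : ℕ × ℤ × ℤ, k ≤ q.1 → (dyadicSquare q ∩ Metric.ball z ε).Nonempty →
      dyadicSquare q ⊆ O := by
  obtain ⟨ρ, hρ, hb⟩ := Metric.isOpen_iff.1 hO z hz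
  obtain ⟨k, hk⟩ := exists_pow_lt_of_lt_one (show 0 < ρ / 4 by positivity)
    (show (1 / 2 : ℝ) < 1 by norm_num)
  refine ⟨ρ / 2, by positivity, k, fun q hq ⟨w, hw, hwz⟩ y hy => hb ?_⟩
  have h1 := norm_sub_le_of_mem_dyadicSquare hy hw
  have h2 : (2 : ℝ) / 2 ^ q.1 ≤ 2 * (1 / 2) ^ k := by
    rw [one_div, inv_pow, ← div_eq_mul_inv]
    gcongr
    norm_num
  rw [Metric.mem_ball, dist_eq_norm] at hwz ⊢
  calc ‖y - z‖ ≤ ‖y - w‖ + ‖w - z‖ := norm_sub_le_norm_sub_add_norm_sub _ _ _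
    _ < ρ := by linarith

theorem exists_mem_tiles (hO : ∀ i, IsOpen (O i)) {z : ℂ} (hz : ∃ i, z ∈ O i) (him : 0 ≤ z.im) :
    ∃ q ∈ tiles O, InHalfOpen q z := by
  classical
  have hex : ∃ k, ∃ i, dyadicSquare (squareAt k z) ⊆ O i := by
    obtain ⟨i, hi⟩ := hz
    obtain ⟨ε, hε, k, hk⟩ := exists_forall_le_subset (hO i) hi
    exact ⟨k, i, hk _ le_rfl ⟨z, (inHalfOpen_squareAt k z).mem, Metric.mem_ball_self hε⟩⟩
  refine ⟨squareAt (Nat.find hex) z, ⟨?_, Nat.find_spec hex, fun q' hq' hs hg => ?_⟩,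
    inHalfOpen_squareAt _ z⟩
  · exact Int.floor_nonneg.2 (by positivity)
  · have h := (inHalfOpen_squareAt (Nat.find hex) z).of_subset hs
    rw [h.eq_squareAt] at hg
    exact Nat.find_min hex hq' hg

theorem finite_dyadicSquare_near (k : ℕ) (z : ℂ) (ε : ℝ) :
    {q : ℕ × ℤ × ℤ | q.1 ≤ k ∧ (dyadicSquare q ∩ Metric.ball z ε).Nonempty}.Finite := by
  have hb : ∀ a : ℝ, ∃ N : ℤ, ∀ l ≤ k, ∀ (x : ℝ) (m : ℤ), |x - a| ≤ ε → (m : ℝ) ≤ 2 ^ l * x →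
      2 ^ l * x ≤ m + 1 → -N ≤ m ∧ m ≤ N := by
    intro a
    obtain ⟨N, hN⟩ := exists_int_gt (2 ^ k * (|a| + ε) + 1)
    refine ⟨N, fun l hl x m hx h1 h2 => ?_⟩
    have hxa : |x| ≤ |a| + ε := by
      have := abs_sub_abs_le_abs_sub x a
      linarith
    have hlx : |2 ^ l * x| ≤ 2 ^ k * (|a| + ε) := by
      rw [abs_mul, abs_of_pos (by positivity : (0 : ℝ) < 2 ^ l)]
      gcongr
      norm_num
    rw [abs_le] at hlx
    constructor
    · have : (-N : ℝ) ≤ m := by linarith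
      exact_mod_cast this
    · have : (m : ℝ) ≤ N := by linarith
      exact_mod_cast this
  obtain ⟨M, hM⟩ := hb z.re
  obtain ⟨N, hN⟩ := hb z.im
  refine ((Set.finite_Iic k).prod ((Set.finite_Icc (-M) M).prod (Set.finite_Icc (-N) N))).subset ?_
  rintro q ⟨hq, w, hw, hwz⟩
  rw [mem_dyadicSquare] at hw
  rw [Metric.mem_ball, dist_eq_norm] at hwz
  exact ⟨hq, hM _ hq w.re _ ((abs_re_le_norm (w - z)).trans hwz.le) hw.1.1 hw.1.2,
    hN _ hq w.im _ ((abs_im_le_norm (w - z)).trans hwz.le) hw.2.1 hw.2.2⟩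

/-- Levels of tiles near z are bounded: if all squares near z of level at least k lie in `O i`, a
tile of level above k would have its parent in `O i` too, against maximality. -/
theorem exists_finite_tiles (hO : ∀ i, IsOpen (O i)) {z : ℂ} (hz : ∃ i, z ∈ O i) :
    ∃ ε > 0, {q | q ∈ tiles O ∧ (dyadicSquare q ∩ Metric.ball z ε).Nonempty}.Finite := by
  obtain ⟨i, hi⟩ := hz
  obtain ⟨ε, hε, k, hk⟩ := exists_forall_le_subset (hO i) hi
  refine ⟨ε, hε, (finite_dyadicSquare_near k z ε).subset ?_⟩
  rintro q ⟨hq, hne⟩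
  refine ⟨?_, hne⟩
  by_contra! hkq
  obtain ⟨w, hw⟩ : (interior (dyadicSquare q)).Nonempty := by
    obtain ⟨y, hy, -⟩ := hne
    exact closure_nonempty_iff.1 ⟨y, dyadicSquare_subset_closure q hy⟩
  have hs : dyadicSquare q ⊆ dyadicSquare (squareAt (q.1 - 1) w) :=
    dyadicSquare_subset (Nat.sub_le _ _) (inHalfOpen_squareAt _ w) (inHalfOpen_of_mem_interior hw)
  refine hq.2.2 _ (Nat.sub_lt (by omega) one_pos) hs ⟨i, hk _ (Nat.le_sub_one_of_lt hkq) ?_⟩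
  exact hne.mono (Set.inter_subset_inter_left _ hs)

theorem eq_of_mem_interior {q q' : ℕ × ℤ × ℤ} (hq : q ∈ tiles O) (hq' : q' ∈ tiles O) {z : ℂ}
    (h : InHalfOpen q z) (h' : InHalfOpen q' z) : q = q' := by
  rcases lt_trichotomy q.1 q'.1 with hlt | heq | hlt
  · exact (hq'.2.2 q hlt (dyadicSquare_subset hlt.le h h') hq.2.1).elim
  · rw [h.eq_squareAt, h'.eq_squareAt, heq]
  · exact (hq.2.2 q' hlt (dyadicSquare_subset hlt.le h' h) hq'.2.1).elim

/-- The tiling by the closed lower half plane and the maximal dyadic squares. -/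
def tiling : Option (tiles O) → Set ℂ
  | none => {z | z.im ≤ 0}
  | some q => dyadicSquare q

theorem tiling_subset_closure (j : Option (tiles O)) :
    tiling O j ⊆ closure (interior (tiling O j)) := by
  cases j with
  | none => simp [tiling]
  | some q => exact dyadicSquare_subset_closure q

theorem isTiling_tiling : IsTiling (tiling O) where
  convex j := by
    cases j with
    | none => exact convex_halfSpace_im_le 0
    | some q => exact convex_dyadicSquare q
  isClosed j := by
    cases j with
    | none => exact isClosed_le continuous_im continuous_const
    | some q => exact isClosed_dyadicSquare q
  subset_closure := tiling_subset_closure O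
  disjoint i j hij := by
    have him : ∀ (q : tiles O) {z}, z ∈ interior (dyadicSquare q) → 0 < z.im := fun q z hz => by
      have h1 := (mem_interior_dyadicSquare.1 hz).2.1
      have h2 : (0 : ℝ) ≤ (q : ℕ × ℤ × ℤ).2.2 := by exact_mod_cast q.2.1
      exact pos_of_mul_pos_right (h2.trans_lt h1) (by positivity)
    rw [Set.disjoint_left]
    intro z hi hj
    -- Each tile lies in the closure of its interior, so it suffices that interiors are disjoint.
    obtain ⟨y, hyi, hyj⟩ := mem_closure_iff.1 (tiling_subset_closure O j hj) _ isOpen_interior hi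
    cases i with
    | none =>
      cases j with
      | none => exact hij rfl
      | some q => exact absurd (him q hyj) (not_lt.2 (show y ∈ tiling O none from interior_subset hyi))
    | some q =>
      cases j with
      | none => exact absurd (him q hyi) (not_lt.2 (show y ∈ tiling O none from interior_subset hyj))
      | some q' =>
        refine hij (congrArg some (Subtype.ext (eq_of_mem_interior O q.2 q'.2
          (inHalfOpen_of_mem_interior hyi) (inHalfOpen_of_mem_interior hyj))))

/-- Above each tile there is a tile abutting it. -/
theorem exists_abutAt_above (hO : ∀ i, IsOpen (O i)) (q : tiles O) :
    ∃ q' : tiles O, (∃ p, AbutAt (dyadicSquare q) (dyadicSquare q') p) ∧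
      ((q : ℕ × ℤ × ℤ).2.2 + 1 : ℝ) / 2 ^ (q : ℕ × ℤ × ℤ).1 <
        ((q' : ℕ × ℤ × ℤ).2.2 + 1 : ℝ) / 2 ^ (q' : ℕ × ℤ × ℤ).1 := by
  obtain ⟨⟨k, m, n⟩, hq⟩ := q
  have hk : (0 : ℝ) < 2 ^ k := by positivity
  -- A point of the top edge. Since 1/3 is not a dyadic fraction, p is on no vertical edge of a
  -- dyadic square, so the half-open tile at p sits directly above, with p in the relative interior
  -- of its bottom edge.
  set p : ℂ := ⟨(m + 1 / 3) / 2 ^ k, (n + 1) / 2 ^ k⟩ with hp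
  have hpre : 2 ^ k * p.re = m + 1 / 3 := mul_div_cancel₀ _ hk.ne'
  have hpim : 2 ^ k * p.im = n + 1 := mul_div_cancel₀ _ hk.ne'
  have hpq : p ∈ dyadicSquare (k, m, n) := by
    rw [mem_dyadicSquare, hpre, hpim]
    norm_num
  have hn : (0 : ℝ) ≤ n := by exact_mod_cast hq.1
  obtain ⟨i, hi⟩ := hq.2.1
  obtain ⟨⟨l, a, b⟩, hq', ⟨h1, h2⟩, h3, h4⟩ := exists_mem_tiles O hO ⟨i, hi hpq⟩
    (show 0 ≤ p.im by positivity)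
  have hl : (0 : ℝ) < 2 ^ l := by positivity
  dsimp only at h1 h2 h3 h4
  have h1' : (a : ℝ) < 2 ^ l * p.re := by
    refine lt_of_le_of_ne h1 fun h => ?_
    have h5 : (a : ℝ) * 2 ^ k * 3 = 2 ^ l * (3 * m + 1) := by
      rw [h, show (2 : ℝ) ^ l * p.re * 2 ^ k * 3 = 2 ^ l * (3 * (2 ^ k * p.re)) by ring, hpre]
      ring
    have h6 : a * 2 ^ k * 3 = 2 ^ l * (3 * m + 1) := by exact_mod_cast h5
    have h7 : (3 : ℤ) ∣ 2 ^ l * (3 * m + 1) := ⟨a * 2 ^ k, by rw [← h6, mul_comm]⟩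
    rcases Int.prime_three.dvd_or_dvd h7 with h8 | h8
    · have := Int.prime_three.dvd_of_dvd_pow h8
      omega
    · omega
  have hpi : p ∉ interior (dyadicSquare (k, m, n)) := fun h => by
    have := (mem_interior_dyadicSquare.1 h).2.2
    dsimp only at this
    linarith
  -- Otherwise p would be interior to its half-open tile. That tile cannot be another one, as p
  -- belongs to q, nor q itself, as p is on its top edge.
  have hbim : (b : ℝ) = 2 ^ l * p.im := by
    by_contra hne
    have hpi' : p ∈ interior (dyadicSquare (l, a, b)) :=
      mem_interior_dyadicSquare.2 ⟨⟨h1', h2⟩, lt_of_le_of_ne h3 hne, h4⟩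
    refine Set.disjoint_left.1 ((isTiling_tiling O).disjoint (some ⟨_, hq'⟩) (some ⟨_, hq⟩) ?_)
      hpi' hpq
    intro h
    simp only [Option.some.injEq, Subtype.mk.injEq] at h
    rw [h] at hpi'
    exact hpi hpi'
  refine ⟨⟨_, hq'⟩, ⟨p, hpq, mem_dyadicSquare.2 ⟨⟨h1'.le, h2.le⟩, h3, h4.le⟩, ?_⟩, ?_⟩
  · have hev : ∀ᶠ z : ℂ in 𝓝 p, ((m : ℝ) < 2 ^ k * z.re ∧ 2 ^ k * z.re < m + 1) ∧
        ((a : ℝ) < 2 ^ l * z.re ∧ 2 ^ l * z.re < a + 1) ∧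
        (n : ℝ) < 2 ^ k * z.im ∧ 2 ^ l * z.im < b + 1 := by
      have c1 : ∀ j : ℕ, ContinuousAt (fun z : ℂ => (2 : ℝ) ^ j * z.re) p := fun j => by fun_prop
      have c2 : ∀ j : ℕ, ContinuousAt (fun z : ℂ => (2 : ℝ) ^ j * z.im) p := fun j => by fun_prop
      exact (((c1 k).eventually_const_lt (by dsimp only; rw [hpre]; linarith)).and
        ((c1 k).eventually_lt_const (by dsimp only; rw [hpre]; linarith))).and
        ((((c1 l).eventually_const_lt h1').and ((c1 l).eventually_lt_const h2)).and
        (((c2 k).eventually_const_lt (by dsimp only; rw [hpim]; linarith)).and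
        ((c2 l).eventually_lt_const h4)))
    filter_upwards [hev] with z ⟨hz1, hz2, hz3, hz4⟩
    rcases le_total z.im p.im with h | h
    · refine Or.inl (mem_dyadicSquare.2 ⟨⟨hz1.1.le, hz1.2.le⟩, hz3.le, ?_⟩)
      rw [← hpim]
      exact mul_le_mul_of_nonneg_left h hk.le
    · refine Or.inr (mem_dyadicSquare.2 ⟨⟨hz2.1.le, hz2.2.le⟩, ?_, hz4.le⟩)
      dsimp only
      rw [hbim]
      exact mul_le_mul_of_nonneg_left h hl.le
  · dsimp only
    rw [show ((n : ℝ) + 1) / 2 ^ k = p.im from rfl, lt_div_iff₀' hl]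
    exact h4

theorem im_nonneg_of_mem {q : ℕ × ℤ × ℤ} (hq : q ∈ tiles O) {z : ℂ} (hz : z ∈ dyadicSquare q) :
    0 ≤ z.im := by
  have h1 := (mem_dyadicSquare.1 hz).2.1
  have h2 : (0 : ℝ) ≤ q.2.2 := by exact_mod_cast hq.1
  exact nonneg_of_mul_nonneg_right (h2.trans h1) (by positivity)

theorem finite_tiles_meeting (hO : ∀ i, IsOpen (O i)) {K : Set ℂ} (hK : IsCompact K)
    (hKO : ∀ z ∈ K, ∃ i, z ∈ O i) : {q | q ∈ tiles O ∧ (dyadicSquare q ∩ K).Nonempty}.Finite := by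
  choose! ε hε hfin using fun z (hz : ∃ i, z ∈ O i) => exists_finite_tiles O hO hz
  obtain ⟨t, htK, ht⟩ := hK.elim_nhds_subcover (fun z => Metric.ball z (ε z)) fun z hz =>
    Metric.ball_mem_nhds z (hε z (hKO z hz))
  refine (t.finite_toSet.biUnion fun z hz => hfin z (hKO z (htK z hz))).subset ?_
  rintro q ⟨hq, w, hwq, hwK⟩
  obtain ⟨z, hz, hwz⟩ := Set.mem_iUnion₂.1 (ht hwK)
  exact Set.mem_biUnion (x := z) hz ⟨hq, w, hwq, hwz⟩

/-- Adjacency of tiles. -/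
def tileGraph : SimpleGraph (tiles O) where
  Adj q q' := q ≠ q' ∧ ∃ p, AbutAt (dyadicSquare q) (dyadicSquare q') p
  symm := ⟨fun _ _ ⟨hne, p, h1, h2, h3⟩ => ⟨hne.symm, p, h2, h1, Set.union_comm _ _ ▸ h3⟩⟩
  loopless := ⟨fun _ h => h.1 rfl⟩

/-- Passing repeatedly to the abutting tile above strictly raises the top edge, so no tile recurs.
-/
theorem infinite_reachable (hO : ∀ i, IsOpen (O i)) (q : tiles O) :
    {q' | (tileGraph O).Reachable q q'}.Infinite := by
  choose up hup hlt using exists_abutAt_above O hO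
  have hadj : ∀ q, (tileGraph O).Adj q (up q) := fun q => ⟨fun h => by
    have := hlt q
    rw [← h] at this
    exact lt_irrefl _ this, hup q⟩
  let height : tiles O → ℝ := fun q =>
    ((q : ℕ × ℤ × ℤ).2.2 + 1 : ℝ) / 2 ^ (q : ℕ × ℤ × ℤ).1
  have hmono : StrictMono fun n => height (up^[n] q) := strictMono_nat_of_lt_succ fun n => by
    rw [Function.iterate_succ_apply']
    exact hlt _
  refine (Set.infinite_range_of_injective (f := fun n => up^[n] q)
    fun a b h => hmono.injective (congrArg height h)).mono ?_
  rintro _ ⟨n, rfl⟩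
  induction n with
  | zero => exact SimpleGraph.Reachable.refl _
  | succ n ih =>
    have h : (tileGraph O).Reachable (up^[n] q) (up^[n + 1] q) := by
      rw [Function.iterate_succ_apply']
      exact (hadj _).reachable
    exact SimpleGraph.Reachable.trans ih h

theorem acyc_nerve_tiling (hO : ∀ i, IsOpen (O i)) (m : ℕ) : Acyc (nerve (tiling O)) (m + 2) := by
  have hfin : ∀ q : tiles O,
      {q' : tiles O | (dyadicSquare q' ∩ dyadicSquare q).Nonempty}.Finite := fun q => by
    obtain ⟨i, hi⟩ := q.2.2.1
    refine Set.Finite.of_finite_image ((finite_tiles_meeting O hO (isCompact_dyadicSquare q)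
      fun z hz => ⟨i, hi hz⟩).subset ?_) Subtype.val_injective.injOn
    rintro _ ⟨q', hq', rfl⟩
    exact ⟨q'.2, hq'⟩
  obtain ⟨s, hs, hwf⟩ := exists_adj_wellFounded (tileGraph O)
    (fun q => (hfin q).subset fun q' ⟨_, p, h1, h2, _⟩ => ⟨p, h2, h1⟩) (infinite_reachable O hO)
  refine (isTiling_tiling O).acyc_nerve (fun q => isCompact_dyadicSquare q) (fun q => ?_)
    (fun q => ⟨(hs q).1.symm, ?_⟩) hwf m
  · refine ((Set.finite_singleton none).union ((hfin q).image some)).subset fun w hw => ?_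
    cases w with
    | none => exact Or.inl rfl
    | some q' => exact Or.inr ⟨q', hw, rfl⟩
  · obtain ⟨-, p, h1, h2, h3⟩ := hs q
    exact ⟨p, h2, h1, Set.union_comm _ _ ▸ h3⟩

/-- Radii of balls meeting only the tiles that contain the centre, and subordinate to the
covering. -/
theorem exists_radius (hO : ∀ i, IsOpen (O i)) :
    ∃ (i : tiles O → Λ) (r : ℂ → ℝ), ∀ z, (∃ i, z ∈ O i) → 0 < r z ∧
      (∀ j, (tiling O j ∩ Metric.ball z (r z)).Nonempty → z ∈ tiling O j) ∧
      ∀ q : tiles O, z ∈ dyadicSquare q → Metric.ball z (r z) ⊆ O (i q) := by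
  choose i hi using fun q : tiles O => q.2.2.1
  have key : ∀ z, (∃ i, z ∈ O i) → ∃ r : ℝ, 0 < r ∧
      (∀ j, (tiling O j ∩ Metric.ball z r).Nonempty → z ∈ tiling O j) ∧
      ∀ q : tiles O, z ∈ dyadicSquare q → Metric.ball z r ⊆ O (i q) := by
    intro z hz
    obtain ⟨ε, hε, hfin⟩ := exists_finite_tiles O hO hz
    have hfin' : {q : tiles O | (dyadicSquare q ∩ Metric.ball z ε).Nonempty}.Finite := by
      refine Set.Finite.of_finite_image (hfin.subset ?_) Subtype.val_injective.injOn
      rintro _ ⟨q', hq', rfl⟩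
      exact ⟨q'.2, hq'⟩
    have hclosed : ∀ j, ∀ᶠ w in 𝓝 z, w ∈ tiling O j → z ∈ tiling O j := fun j => by
      by_cases h : z ∈ tiling O j
      · exact Filter.Eventually.of_forall fun _ _ => h
      · filter_upwards [((isTiling_tiling O).isClosed j).isOpen_compl.mem_nhds h] with w hw hw'
        exact (hw hw').elim
    have hopen : ∀ q : tiles O, ∀ᶠ w in 𝓝 z, z ∈ dyadicSquare q → w ∈ O (i q) := fun q => by
      by_cases h : z ∈ dyadicSquare q
      · filter_upwards [(hO (i q)).mem_nhds (hi q h)] with w hw _ using hw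
      · exact Filter.Eventually.of_forall fun _ h' => (h h').elim
    obtain ⟨δ, hδ, hb⟩ := Metric.eventually_nhds_iff_ball.1 ((hclosed none).and
      ((Filter.eventually_all_finite hfin').2 fun q _ => (hclosed (some q)).and (hopen q)))
    refine ⟨min ε δ, lt_min hε hδ, fun j ⟨w, hw, hwz⟩ => ?_, fun q hq w hw => ?_⟩
    · have hwδ := hb w (Metric.ball_subset_ball (min_le_right _ _) hwz)
      cases j with
      | none => exact hwδ.1 hw
      | some q =>
        exact (hwδ.2 q ⟨w, hw, Metric.ball_subset_ball (min_le_left _ _) hwz⟩).1 hw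
    · exact ((hb w (Metric.ball_subset_ball (min_le_right _ _) hw)).2 q
        ⟨z, hq, Metric.mem_ball_self hε⟩).2 hq
  choose! r hr using key
  exact ⟨i, r, hr⟩

variable {O}

/-- The thickening of a tile by half of the radius function. -/
def thicken (O : Λ → Set ℂ) (r : ℂ → ℝ) (j : Option (tiles O)) : Set ℂ :=
  {y | ∃ z ∈ tiling O j, (∃ i, z ∈ O i) ∧ y ∈ Metric.ball z (r z / 2)}

theorem isOpen_thicken (r : ℂ → ℝ) (j : Option (tiles O)) : IsOpen (thicken O r j) := by
  have : thicken O r j =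
      ⋃ z ∈ {z | z ∈ tiling O j ∧ ∃ i, z ∈ O i}, Metric.ball z (r z / 2) := by
    ext y
    simp [thicken, and_assoc]
  rw [this]
  exact isOpen_biUnion fun _ _ => Metric.isOpen_ball

theorem mem_thicken {r : ℂ → ℝ} {j : Option (tiles O)} {z : ℂ} (hz : z ∈ tiling O j)
    (hzO : ∃ i, z ∈ O i) (hr : 0 < r z) : z ∈ thicken O r j :=
  ⟨z, hz, hzO, Metric.mem_ball_self (half_pos hr)⟩

/-- A thickened tiling has the same nerve. -/
theorem nerve_of_mem_thicken {r : ℂ → ℝ} (hr : ∀ z, (∃ i, z ∈ O i) →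
      ∀ j, (tiling O j ∩ Metric.ball z (r z)).Nonempty → z ∈ tiling O j)
    {m : ℕ} (L : Fin (m + 1) → Option (tiles O)) {y : ℂ} (hy : ∀ k, y ∈ thicken O r (L k)) :
    nerve (tiling O) (Set.range L) := by
  choose z hz hzO hyz using hy
  -- The centre of largest radius lies in all the tiles: its distance to any other centre is less
  -- than half the sum of the two radii, hence less than its own radius.
  obtain ⟨k₀, hk₀⟩ := Finite.exists_max fun k => r (z k)
  refine ⟨z k₀, ?_⟩
  rintro _ ⟨k, rfl⟩
  refine hr _ (hzO k₀) _ ⟨z k, hz k, ?_⟩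
  have h1 := hyz k
  have h2 := hyz k₀
  have h3 := hk₀ k
  rw [Metric.mem_ball] at h1 h2 ⊢
  rw [dist_comm] at h1
  linarith [dist_triangle (z k) y (z k₀)]

end Tiles

/-! ### The half plane of an axially symmetric set -/

/-- The point `x + i |y|` of the upper half plane that represents the sphere of `x + I y`. -/
noncomputable def profile (q : ℍ[ℝ]) : ℂ := ⟨q.re, ‖q.im‖⟩

theorem continuous_profile : Continuous profile := by
  have h : profile = fun q => Complex.equivRealProdCLM.symm (q.re, ‖q.im‖) := rfl
  rw [h]
  exact Complex.equivRealProdCLM.symm.continuous.comp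
    (Quaternion.continuous_re.prodMk Quaternion.continuous_im.norm)

theorem continuous_coeComplex : Continuous Quaternion.coeComplex :=
  LinearMap.continuous_of_finiteDimensional (Quaternion.ofComplex : ℂ →ₐ[ℝ] ℍ[ℝ]).toLinearMap

theorem coeComplex_I_mem : Quaternion.coeComplex Complex.I ∈ imagUnits := by
  have h : Quaternion.coeComplex Complex.I * Quaternion.coeComplex Complex.I = -1 := by
    rw [← Quaternion.coeComplex_mul, Complex.I_mul_I]
    ext <;> simp
  exact h

theorem neg_mem_imagUnits {I : ℍ[ℝ]} (hI : I ∈ imagUnits) : -I ∈ imagUnits := by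
  have h : I * I = -1 := hI
  change -I * -I = -1
  rw [neg_mul_neg, h]

theorem coeComplex_eq (z : ℂ) :
    Quaternion.coeComplex z = (z.re : ℍ[ℝ]) + Quaternion.coeComplex Complex.I * (z.im : ℍ[ℝ]) := by
  ext <;> simp

theorem norm_eq_one_of_mem {I : ℍ[ℝ]} (hI : I ∈ imagUnits) : ‖I‖ = 1 := by
  have h := congrArg norm (show I * I = -1 from hI)
  rw [norm_mul, norm_neg, norm_one] at h
  nlinarith [norm_nonneg I]

theorem re_eq_zero_of_mem {I : ℍ[ℝ]} (hI : I ∈ imagUnits) : I.re = 0 := by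
  have hI2 : I * I = -1 := hI
  rw [← Quaternion.sq_eq_neg_normSq, sq, hI2, Quaternion.normSq_eq_norm_mul_self,
    norm_eq_one_of_mem hI]
  simp

theorem profile_eq {I : ℍ[ℝ]} (hI : I ∈ imagUnits) (x y : ℝ) :
    profile ((x : ℍ[ℝ]) + I * (y : ℍ[ℝ])) = ⟨x, |y|⟩ := by
  have him : ((x : ℍ[ℝ]) + I * (y : ℍ[ℝ])).im = y • I := by
    ext <;> simp [re_eq_zero_of_mem hI, mul_comm]
  refine Complex.ext ?_ ?_
  · simp [profile, re_eq_zero_of_mem hI]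
  · simp only [profile]
    rw [him, norm_smul, norm_eq_one_of_mem hI, mul_one, Real.norm_eq_abs]

theorem profile_coeComplex {z : ℂ} (hz : 0 ≤ z.im) : profile (Quaternion.coeComplex z) = z := by
  rw [coeComplex_eq, profile_eq coeComplex_I_mem, abs_of_nonneg hz]

theorem exists_eq_add_mul (q : ℍ[ℝ]) :
    ∃ I ∈ imagUnits, q = (q.re : ℍ[ℝ]) + I * (‖q.im‖ : ℝ) := by
  by_cases h : q.im = 0
  · refine ⟨_, coeComplex_I_mem, ?_⟩
    conv_lhs => rw [← Quaternion.re_add_im q]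
    simp [h]
  · have hn : ‖q.im‖ ≠ 0 := norm_ne_zero_iff.2 h
    refine ⟨‖q.im‖⁻¹ • q.im, ?_, ?_⟩
    · change ‖q.im‖⁻¹ • q.im * ‖q.im‖⁻¹ • q.im = -1
      rw [smul_mul_smul_comm, ← sq q.im, Quaternion.im_sq, Quaternion.normSq_eq_norm_mul_self,
        ← mul_inv, ← Quaternion.coe_neg, ← Quaternion.coe_smul, smul_eq_mul, mul_neg,
        inv_mul_cancel₀ (mul_ne_zero hn hn), Quaternion.coe_neg, Quaternion.coe_one]
    · rw [← Quaternion.coe_commutes, Quaternion.coe_mul_eq_smul, smul_smul, mul_inv_cancel₀ hn,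
        one_smul, Quaternion.re_add_im]

/-- Both points lie on the same sphere x + 𝕊y. -/
theorem IsAxiallySymmetric.mem_iff {U : Set ℍ[ℝ]} (hU : IsAxiallySymmetric U) (q : ℍ[ℝ]) :
    Quaternion.coeComplex (profile q) ∈ U ↔ q ∈ U := by
  obtain ⟨I, hI, hq⟩ := exists_eq_add_mul q
  have hp := coeComplex_eq (profile q)
  constructor
  · intro h
    rw [← show symmetrization U = U from hU]
    exact ⟨_, _, I, hI, hq, _, coeComplex_I_mem, hp ▸ h⟩
  · intro h
    rw [← show symmetrization U = U from hU]
    exact ⟨_, _, _, coeComplex_I_mem, hp, I, hI, hq ▸ h⟩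

theorem isAxiallySymmetric_preimage (N : Set ℂ) : IsAxiallySymmetric (profile ⁻¹' N) := by
  refine Set.Subset.antisymm ?_ fun q hq => ?_
  · rintro _ ⟨x, y, I, hI, rfl, J, hJ, h⟩
    rw [Set.mem_preimage, profile_eq hJ] at h
    rwa [Set.mem_preimage, profile_eq hI]
  · obtain ⟨I, hI, hqI⟩ := exists_eq_add_mul q
    exact ⟨_, _, I, hI, hqI, I, hI, hqI ▸ hq⟩

theorem mem_realAxis_iff {q : ℍ[ℝ]} : q ∈ realAxis ↔ q.im = 0 := by
  constructor
  · rintro ⟨x, rfl⟩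
    simp
  · intro h
    refine ⟨q.re, ?_⟩
    conv_rhs => rw [← Quaternion.re_add_im q, h, add_zero]

theorem imUnit_of_mem_realAxis {q : ℍ[ℝ]} (hq : q ∈ realAxis) : imUnit q = 0 := by
  rw [imUnit, mem_realAxis_iff.1 hq, smul_zero]

theorem imUnit_ne_zero {q : ℍ[ℝ]} (hq : q ∉ realAxis) : imUnit q ≠ 0 := by
  rw [mem_realAxis_iff] at hq
  exact smul_ne_zero (inv_ne_zero (norm_ne_zero_iff.2 hq)) hq

/-! ### Sections as integers -/

theorem eq_zero_of_zsmul_eq_zero {n : ℤ} {q : ℍ[ℝ]} (h : n • q = 0) (hq : q ≠ 0) : n = 0 := by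
  rw [← Int.cast_smul_eq_zsmul ℝ, smul_eq_zero] at h
  exact_mod_cast h.resolve_right hq

/-- A section over an open set is an integral multiple of the imaginary unit function, and the
integer vanishes if the set meets the real axis. -/
theorem exists_int_of_section {U : Set ℍ[ℝ]} (hU : IsOpen U) (f : sections U) :
    ∃ n : ℤ, (∀ q : U, f.1 q = n • imUnit q) ∧ ((U ∩ realAxis).Nonempty → n = 0) := by
  classical
  obtain ⟨f, hf, n, hn⟩ := f
  -- Approach x along x + It with t > 0, where the section is constantly nI.
  have key : ∀ x : ℝ, ∀ hx : (x : ℍ[ℝ]) ∈ U, ∀ I ∈ imagUnits, f ⟨x, hx⟩ = n • I := by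
    intro x hx I hI
    set F : ℍ[ℝ] → ℍ[ℝ] := fun q => if h : q ∈ U then f ⟨q, h⟩ else 0 with hF
    have hFc : ContinuousAt F x := by
      refine ContinuousOn.continuousAt ?_ (hU.mem_nhds hx)
      rw [continuousOn_iff_continuous_domRestrict]
      convert hf using 1
      funext q
      simp [hF]
    set γ : ℝ → ℍ[ℝ] := fun t => (x : ℍ[ℝ]) + I * (t : ℍ[ℝ]) with hγ
    have hγc : Filter.Tendsto γ (𝓝[>] 0) (𝓝 (x : ℍ[ℝ])) := by
      have : Continuous γ :=
        continuous_const.add (continuous_const.mul Quaternion.continuous_coe)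
      have h0 := this.tendsto 0
      simp only [hγ, Quaternion.coe_zero, mul_zero, add_zero] at h0
      exact h0.mono_left nhdsWithin_le_nhds
    have h1 : Filter.Tendsto (fun t => F (γ t)) (𝓝[>] 0) (𝓝 (F x)) := hFc.tendsto.comp hγc
    have h2 : Filter.Tendsto (fun t => F (γ t)) (𝓝[>] 0) (𝓝 (n • I)) := by
      refine tendsto_const_nhds.congr' ?_
      filter_upwards [hγc.eventually (hU.mem_nhds hx), self_mem_nhdsWithin] with t ht ht0
      have him : imUnit (γ t) = I := imUnit_eq hI x ht0
      have hne : γ t ∉ realAxis := fun h => by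
        have h0 := imUnit_of_mem_realAxis h
        rw [him] at h0
        have := norm_eq_one_of_mem hI
        rw [h0, norm_zero] at this
        exact zero_ne_one this
      exact ((dif_pos ht : F (γ t) = f ⟨γ t, ht⟩).trans
        ((hn ⟨γ t, ht⟩ hne).trans (by rw [him]))).symm
    exact (dif_pos hx : F x = f ⟨x, hx⟩).symm.trans (tendsto_nhds_unique h1 h2)
  have hI := coeComplex_I_mem
  have hI0 : Quaternion.coeComplex Complex.I ≠ 0 := fun h => by
    have := norm_eq_one_of_mem hI
    rw [h, norm_zero] at this
    exact zero_ne_one this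
  have hzero : (U ∩ realAxis).Nonempty → n = 0 := by
    rintro ⟨_, hx, x, rfl⟩
    -- The values obtained from I and from -I agree, so 2nI = 0.
    have h := (key x hx _ hI).symm.trans (key x hx _ (neg_mem_imagUnits hI))
    rw [smul_neg, eq_neg_iff_add_eq_zero, ← add_smul] at h
    have := eq_zero_of_zsmul_eq_zero h hI0
    omega
  refine ⟨n, fun q => ?_, hzero⟩
  by_cases hq : (q : ℍ[ℝ]) ∈ realAxis
  · obtain ⟨q, hqU⟩ := q
    obtain ⟨x, rfl⟩ := hq
    refine (key x hqU _ hI).trans ?_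
    rw [hzero ⟨_, hqU, x, rfl⟩, zero_smul, zero_smul]
  · exact hn q hq

/-- The section over `U` given by an integer that vanishes if `U` meets the real axis. -/
noncomputable def ofInt (U : Set ℍ[ℝ]) (n : ℤ) (h : (U ∩ realAxis).Nonempty → n = 0) : sections U :=
  ⟨fun q => n • imUnit q, by
    by_cases hU : (U ∩ realAxis).Nonempty
    · simp only [h hU, zero_smul]
      exact continuous_const
    · refine Continuous.const_smul ?_ n
      have him : Continuous fun q : U => (q : ℍ[ℝ]).im :=
        Quaternion.continuous_im.comp continuous_subtype_val
      refine Continuous.smul (him.norm.inv₀ fun q => norm_ne_zero_iff.2 fun hq => ?_) him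
      exact hU ⟨q, q.2, mem_realAxis_iff.2 hq⟩, n, fun _ _ => rfl⟩

variable {Ω : Set ℍ[ℝ]}

/-! ### The refinement by thickened tiles -/

/-- The trace of a covering on the plane `ℝ + iℝ`. -/
def Covering.trace (𝒰 : Covering Ω) (i : 𝒰.Idx) : Set ℂ := Quaternion.coeComplex ⁻¹' 𝒰.U i

theorem Covering.isOpen_trace (𝒰 : Covering Ω) (i : 𝒰.Idx) : IsOpen (𝒰.trace i) :=
  (𝒰.isOpen i).preimage continuous_coeComplex

theorem Covering.mem_trace (𝒰 : Covering Ω) (i : 𝒰.Idx) (q : ℍ[ℝ]) :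
    profile q ∈ 𝒰.trace i ↔ q ∈ 𝒰.U i :=
  (𝒰.isAxiallySymmetric i).mem_iff q

/-- Every covering has a refinement by axially symmetric sets whose intersection pattern, among each
other and with the real axis, has no cohomology in degrees at least two. -/
theorem exists_refinement_acyc (𝒰 : Covering Ω) :
    ∃ (𝒱 : Covering Ω) (_ : Refinement 𝒰 𝒱) (K : Set (Option 𝒱.Idx) → Prop),
      (∀ s t, s ⊆ t → K t → K s) ∧ (∀ m, Acyc K (m + 2)) ∧
      (∀ (m : ℕ) (L : Fin (m + 1) → 𝒱.Idx),
        K (Set.range (some ∘ L)) ↔ (𝒱.inter L).Nonempty) ∧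
      ∀ (m : ℕ) (L : Fin (m + 1) → 𝒱.Idx),
        K (insert none (Set.range (some ∘ L))) ↔ (𝒱.inter L ∩ realAxis).Nonempty := by
  obtain ⟨i, r, hr⟩ := exists_radius 𝒰.trace 𝒰.isOpen_trace
  have hV : ∀ q : tiles 𝒰.trace,
      profile ⁻¹' thicken 𝒰.trace r (some q) ⊆ 𝒰.U (i q) := fun q y hy => by
    obtain ⟨z, hz, hzO, hyz⟩ := hy
    rw [← 𝒰.mem_trace]
    exact (hr z hzO).2.2 q hz (Metric.ball_subset_ball (by linarith [(hr z hzO).1]) hyz)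
  have hmemO : ∀ q ∈ Ω, ∃ j, profile q ∈ 𝒰.trace j := fun q hq => by
    rw [← 𝒰.iUnion_eq] at hq
    obtain ⟨j, hj⟩ := Set.mem_iUnion.1 hq
    exact ⟨j, (𝒰.mem_trace j q).2 hj⟩
  have hUΩ : ∀ j, 𝒰.U j ⊆ Ω := fun j => (Set.subset_iUnion 𝒰.U j).trans 𝒰.iUnion_eq.subset
  let 𝒱 : Covering Ω :=
    { Idx := tiles 𝒰.trace
      U := fun q => profile ⁻¹' thicken 𝒰.trace r (some q)
      isOpen := fun q => (isOpen_thicken r _).preimage continuous_profile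
      isAxiallySymmetric := fun q => isAxiallySymmetric_preimage _
      iUnion_eq := by
        refine Set.Subset.antisymm (Set.iUnion_subset fun q => (hV q).trans (hUΩ _)) fun y hy => ?_
        obtain ⟨q, hq, hyq⟩ := exists_mem_tiles 𝒰.trace 𝒰.isOpen_trace (hmemO y hy)
          (norm_nonneg y.im)
        exact Set.mem_iUnion.2
          ⟨⟨q, hq⟩, mem_thicken hyq.mem (hmemO y hy) (hr _ (hmemO y hy)).1⟩ }
  have hr' : ∀ z, (∃ i, z ∈ 𝒰.trace i) → ∀ j,
      (tiling 𝒰.trace j ∩ Metric.ball z (r z)).Nonempty → z ∈ tiling 𝒰.trace j :=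
    fun z hz => (hr z hz).2.1
  have hmem : ∀ {m : ℕ} (L : Fin (m + 1) → 𝒱.Idx) {z : ℂ},
      (∀ j ∈ Set.range (some ∘ L), z ∈ tiling 𝒰.trace j) →
      Quaternion.coeComplex z ∈ 𝒱.inter L := fun {m} L {z} hz => by
    refine Set.mem_iInter.2 fun k => ?_
    have hzk : z ∈ dyadicSquare (L k) := hz _ ⟨k, rfl⟩
    have hzO : ∃ j, z ∈ 𝒰.trace j := by
      obtain ⟨j, hj⟩ := (L k).2.2.1
      exact ⟨j, hj hzk⟩
    change profile (Quaternion.coeComplex z) ∈ thicken 𝒰.trace r (some (L k))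
    rw [profile_coeComplex (im_nonneg_of_mem _ (L k).2 hzk)]
    exact mem_thicken hzk hzO (hr z hzO).1
  refine ⟨𝒱, ⟨i, hV⟩, nerve (tiling 𝒰.trace), nerve_mono _, acyc_nerve_tiling _ 𝒰.isOpen_trace,
    fun m L => ⟨fun ⟨z, hz⟩ => ⟨_, hmem L hz⟩, fun ⟨y, hy⟩ => ?_⟩,
    fun m L => ⟨fun ⟨z, hz⟩ => ?_, fun ⟨y, hy, hyR⟩ => ?_⟩⟩
  · exact nerve_of_mem_thicken hr' (some ∘ L) (y := profile y) fun k => Set.mem_iInter.1 hy k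
  · refine ⟨_, hmem L fun j hj => hz j (Set.mem_insert_of_mem _ hj), z.re, ?_⟩
    have h1 : z.im ≤ 0 := hz none (Set.mem_insert _ _)
    have h2 : 0 ≤ z.im := im_nonneg_of_mem _ (L 0).2 (hz (some (L 0)) (Or.inr ⟨0, rfl⟩))
    rw [coeComplex_eq z, le_antisymm h1 h2]
    simp
  · rw [← Fin.range_cons]
    refine nerve_of_mem_thicken hr' _ (y := profile y) fun k => ?_
    refine Fin.cases ?_ (fun k => Set.mem_iInter.1 hy k) k
    have hyO : ∃ j, profile y ∈ 𝒰.trace j :=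
      hmemO y (hUΩ _ (hV _ (Set.mem_iInter.1 hy 0)))
    refine mem_thicken ?_ hyO (hr _ hyO).1
    change ‖y.im‖ ≤ 0
    rw [mem_realAxis_iff.1 hyR, norm_zero]

/-! ### Vanishing of classes in the direct limit -/

theorem Covering.isOpen_inter (𝒰 : Covering Ω) {m : ℕ} (L : Fin m → 𝒰.Idx) :
    IsOpen (𝒰.inter L) :=
  isOpen_iInter_of_finite fun k => 𝒰.isOpen (L k)

/-- Every cocycle of degree at least two becomes a coboundary on a suitable refinement. -/
theorem exists_refinement_mem_coboundaries (𝒰 : Covering Ω) (m : ℕ) (c : Cochain 𝒰 (m + 2))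
    (hc : coboundary 𝒰 (m + 2) c = 0) :
    ∃ (𝒱 : Covering Ω) (ρ : Refinement 𝒰 𝒱), ρ.cochainMap (m + 2) c ∈ coboundaries 𝒱 (m + 2) := by
  classical
  obtain ⟨𝒱, ρ, K, hK, hacyc, hKV, hKR⟩ := exists_refinement_acyc 𝒰
  refine ⟨𝒱, ρ, ?_⟩
  set c' := ρ.cochainMap (m + 2) c with hc'
  have hδc' : coboundary 𝒱 (m + 2) c' = 0 := by rw [hc', ρ.coboundary_cochainMap, hc, map_zero]
  -- Over an empty intersection `N L` is arbitrary; its value matters only where L spans a simplex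
  -- of K.
  choose N hN hN0 using fun L => exists_int_of_section (𝒱.isOpen_inter L) (c' L)
  -- Extension by zero to tuples through `none`. It is closed there too: a face without `none` spans
  -- a simplex with it, so its intersection meets the real axis and its integer is 0.
  let f : (Fin (m + 3) → Option 𝒱.Idx) → ℤ := fun L =>
    if h : ∀ i, (L i).isSome then N fun i => (L i).get (h i) else 0
  have hfsome : ∀ L, f (some ∘ L) = N L := fun L => by simp [f]
  have hsome : ∀ {k : ℕ} (L : Fin k → Option 𝒱.Idx), (∀ i, (L i).isSome) →
      ∃ L', L = some ∘ L' := fun L h => ⟨fun i => (L i).get (h i), by funext i; simp⟩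
  have hfnone : ∀ L, K (insert none (Set.range L)) → f L = 0 := fun L hL => by
    by_cases h : ∀ i, (L i).isSome
    · obtain ⟨L, rfl⟩ := hsome L h
      rw [hfsome]
      exact hN0 L ((hKR _ L).1 hL)
    · exact dif_neg h
  have hf : ∀ L, K (Set.range L) → coface f L = 0 := by
    intro L hL
    by_cases h : ∀ i, (L i).isSome
    · obtain ⟨L, rfl⟩ := hsome L h
      by_cases hR : (𝒱.inter L ∩ realAxis).Nonempty
      · exact coface_eq_zero fun k => hfnone _ (hK _ _
          (Set.insert_subset_insert (range_comp_succAbove_subset _ k)) ((hKR _ L).2 hR))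
      obtain ⟨q, hq⟩ := (hKV _ L).1 hL
      have hqR : q ∉ realAxis := fun h => hR ⟨q, hq, h⟩
      refine eq_zero_of_zsmul_eq_zero ?_ (imUnit_ne_zero hqR)
      have h0 := coboundary_apply 𝒱 (m + 2) c' L ⟨q, hq⟩
      rw [hδc'] at h0
      refine Eq.trans ?_ h0.symm
      rw [coface, Finset.sum_smul]
      refine Finset.sum_congr rfl fun k _ => ?_
      rw [hN, smul_assoc]
      congr 2
      exact hfsome (L ∘ k.succAbove)
    · push Not at h
      obtain ⟨i, hi⟩ := h
      have hi' : none ∈ Set.range L := ⟨i, by simpa using hi⟩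
      exact coface_eq_zero fun k => hfnone _
        (hK _ _ (Set.insert_subset hi' (range_comp_succAbove_subset _ k)) hL)
  obtain ⟨g, hg⟩ := hacyc m f hf
  -- The primitive g need not vanish over the real axis. On the simplices that span one with `none`
  -- it is closed, as f vanishes there, and they form a cone, so g is the coboundary of g' there.
  -- Subtracting that coboundary yields integers that vanish over the real axis and still have
  -- coboundary f.
  obtain ⟨g', hg'⟩ := acyc_of_cone (K := fun t => K (insert none t)) none
    (fun t ht => by rwa [Set.insert_idem]) (m + 1) g fun L hL => by
      rw [← hg L (hK _ _ (Set.subset_insert _ _) hL), hfnone L hL]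
  let b : (Fin (m + 2) → 𝒱.Idx) → ℤ := fun L => g (some ∘ L) - coface g' (some ∘ L)
  have hb : ∀ L, (𝒱.inter L ∩ realAxis).Nonempty → b L = 0 := fun L hL =>
    sub_eq_zero.2 (hg' _ ((hKR _ L).2 hL))
  refine ⟨fun L => ofInt _ (b L) (hb L), ?_⟩
  funext L
  ext1
  funext q
  have hL : K (Set.range (some ∘ L)) := (hKV _ L).2 ⟨q, q.2⟩
  have hbL : coface b L = N L := by
    rw [← hfsome, hg _ hL, ← sub_zero (coface g (some ∘ L)), ← coface_coface g' (some ∘ L),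
      ← coface_sub]
    rfl
  rw [coboundary_apply, hN, ← hbL, coface, Finset.sum_smul]
  refine Finset.sum_congr rfl fun k _ => ?_
  rw [smul_assoc]
  rfl

/-- The Čech cohomology vanishes if every cocycle becomes a coboundary on some refinement. -/
theorem subsingleton_cohomology (n : ℕ) (h : ∀ (𝒰 : Covering Ω) (c : Cochain 𝒰 n),
      coboundary 𝒰 n c = 0 →
      ∃ (𝒱 : Covering Ω) (ρ : Refinement 𝒰 𝒱), ρ.cochainMap n c ∈ coboundaries 𝒱 n) :
    Subsingleton (cohomology Ω n) := by
  classical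
  suffices key : ∀ x, x ∈ limitRelations Ω n by
    refine ⟨fun a b => ?_⟩
    obtain ⟨x, rfl⟩ := QuotientAddGroup.mk_surjective a
    obtain ⟨y, rfl⟩ := QuotientAddGroup.mk_surjective b
    rw [(QuotientAddGroup.eq_zero_iff x).2 (key x), (QuotientAddGroup.eq_zero_iff y).2 (key y)]
  intro x
  induction x using DirectSum.induction_on with
  | zero => exact zero_mem _
  | add x y hx hy => exact add_mem hx hy
  | of 𝒰 a =>
    obtain ⟨c, rfl⟩ := QuotientAddGroup.mk_surjective a
    obtain ⟨𝒱, ρ, hρ⟩ := h 𝒰 c.1 c.2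
    have h0 : ρ.cohomologyMap n (c : coverCohomology 𝒰 n) = 0 :=
      (QuotientAddGroup.eq_zero_iff _).2 hρ
    exact AddSubgroup.subset_closure
      ⟨𝒰, 𝒱, ρ, (c : coverCohomology 𝒰 n), by rw [h0, map_zero, sub_zero]⟩

end AxCech

theorem mainTheorem10 (Ω : Set (Quaternion ℝ)) (hΩ : AxCech.IsAxiallySymmetricDomain Ω)
    (n : ℕ) (hn : 2 ≤ n) : Subsingleton (AxCech.cohomology Ω n) := by
  obtain ⟨m, rfl⟩ := Nat.exists_eq_add_of_le' hn
  exact AxCech.subsingleton_cohomology _ fun 𝒰 c hc =>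
    AxCech.exists_refinement_mem_coboundaries 𝒰 m c hc
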